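/- Let $T=\mathbb R^4/\mathbb Z^4$ carry the complexified symplectic form $\omega=\tau_1\,dx_1\wedge dy_1+\tau_2\,dx_2\wedge dy_2+\tau_3(dx_1\wedge dy_2+dx_2\wedge dy_1)$, where $\tau_1,\tau_2,\tau_3\in\mathbb C$ and the imaginary part of $\begin{pmatrix}\tau_1&\tau_3\\ \tau_3&\tau_2\end{pmatrix}$ is positive definite. Write $Q(u,v)=\tau_1u^2+\tau_2v^2+2\tau_3uv$. For $b=(b_1,b_2)\in\mathbb R^2$ let $\rho(x_1,x_2,y_1,y_2)=(x_1+b_1,x_2+b_2,y_1+3x_1,y_2+3x_2)$ on the universal cover, let $L=\{y_1=y_2=0\}$, and let $\mathcal R(T)=\bigoplus_{l\ge0}\mathrm{Hom}(L,\rho^lL)$ be the following graded $\mathbb C$-algebra. Its degree $0$ part is $\mathbb C\cdot 1$. For $l\ge1$ its degree $l$ part has as basis the intersection points $Y^l_{a}$, $a=(a_1,a_2)\in(\mathbb Z/3l)^2$, of $L$ and $\rho^lL$, where $Y^l_a$ has coordinates $x_i=\frac{a_i}{3l}+\frac{l+1}{2}b_i$, $y_i=0$. The product counts triangles weighted by $e^{2\pi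 i\cdot(\omega\text{-area})}$: for $k,l\ge1$, $$Y^k_aY^l_c=\sum_{i\in(\mathbb Z/(k+l))^2}\theta_{k,l}(kc-la+3kl\,i,\,b)\;Y^{k+l}_{a+c+3l\,i},\qquad \theta_{k,l}(s,b)=\sum_{m\in\mathbb Z^2}\exp\Big(\pi i\,N\,Q\big(m+\tfrac{s}{N}+\tfrac b2\big)\Big),\quad N=3kl(k+l).$$ For $k=l=1$ this is $Y^1_aY^1_c=\sum_{i\in(\mathbb Z/2)^2}\theta(c_1-a_1+3i_1,c_2-a_2+3i_2,b_1,b_2,1)\,Y^2_{a+c+3i}$, where $$\theta(a_1,a_2,b_1,b_2,l)=\sum_{m,n\in\mathbb Z}\exp\Big(6l\pi i\,Q\big(m+\tfrac{a_1}{6l}+\tfrac{b_1}{2},\;n+\tfrac{a_2}{6l}+\tfrac{b_2}{2}\big)\Big).$$ Then $\theta(a_1,a_2,0,0,1)=\theta(6-a_1,6-a_2,0,0,1)$ for all $a_1,a_2\in\mathbb Z$. If $b_1,b_2\in\mathbb Z$, then $\mathcal R(T)$ is commutative, and the homomorphism of graded $\mathbb C$-algebras $$\mathbb C[Z_{ij}\mid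 i,j\in\mathbb Z/3]\longrightarrow\mathcal R(T),\qquad Z_{ij}\longmapsto Y^1_{i,j},$$ from the polynomial ring in nine variables of degree one is surjective. Consequently the mirror of $T$, that is $X:=\operatorname{Proj}\mathcal R(T)$, is embedded in $\mathbb P^8$: the morphism of $\mathbb C$-schemes $X\to\operatorname{Proj}\mathbb C[Z_{ij}]=\mathbb P^8_{\mathbb C}$ induced by this homomorphism is everywhere defined and is a closed immersion. -/

import Mathlib

noncomputable section

open Complex

/-- The coefficients of the complexified symplectic form
`ω = τ₁ dx₁∧dy₁ + τ₂ dx₂∧dy₂ + τ₃ (dx₁∧dy₂ + dx₂∧dy₁)` on the four-torus `T = ℝ⁴/ℤ⁴`.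
The imaginary part of the symmetric matrix `((τ₁, τ₃), (τ₃, τ₂))` is positive definite; this is
what makes all the theta series converge. -/
structure TorusForm where
  τ₁ : ℂ
  τ₂ : ℂ
  τ₃ : ℂ
  im_pos : 0 < τ₁.im
  im_det_pos : 0 < τ₁.im * τ₂.im - τ₃.im ^ 2

namespace TorusForm

/-- The quadratic form `τ₁ u² + τ₂ v² + 2 τ₃ u v`. -/
def quad (τ : TorusForm) (u v : ℝ) : ℂ :=
  τ.τ₁ * (u : ℂ) ^ 2 + τ.τ₂ * (v : ℂ) ^ 2 + 2 * τ.τ₃ * (u : ℂ) * (v : ℂ)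

/-- The theta function `θ(a₁, a₂, b₁, b₂, l)`. -/
def theta (τ : TorusForm) (a₁ a₂ : ℤ) (b₁ b₂ : ℝ) (l : ℕ) : ℂ :=
  ∑' m : ℤ × ℤ,
    cexp (6 * l * Real.pi * I * τ.τ₁ * (m.1 + a₁ / (6 * l) + b₁ / 2) ^ 2) *
    cexp (6 * l * Real.pi * I * τ.τ₂ * (m.2 + a₂ / (6 * l) + b₂ / 2) ^ 2) *
    cexp (12 * l * Real.pi * I * τ.τ₃ *
      (m.1 + a₁ / (6 * l) + b₁ / 2) * (m.2 + a₂ / (6 * l) + b₂ / 2))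

/-- The theta function `θ_{k,l}(a₁, a₂, b₁, b₂)` that enters the product of an element of degree
`k` with an element of degree `l`.  For `k = l = 1` it is `θ(a₁, a₂, b₁, b₂, 1)`. -/
def thetaKL (τ : TorusForm) (a₁ a₂ : ℤ) (b₁ b₂ : ℝ) (k l : ℕ) : ℂ :=
  ∑' m : ℤ × ℤ, cexp (Real.pi * I * ((3 * k * l * (k + l) : ℕ) : ℂ) *
    τ.quad (m.1 + a₁ / (3 * k * l * (k + l) : ℕ) + b₁ / 2)
      (m.2 + a₂ / (3 * k * l * (k + l) : ℕ) + b₂ / 2))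

/-- `exp (2πi A)`, where `A` is the `ω`-area of a triangle in `ℝ⁴` with one side on each of three
Lagrangian planes of slopes `0`, `3k`, `3(k+l)` and whose vertex on the first two planes is
displaced by `(u, v)` in the `x`-directions from the vertex on the last two. -/
def triangleWeight (τ : TorusForm) (k l : ℕ) (u v : ℝ) : ℂ :=
  cexp (Real.pi * I * ((3 * k * l : ℝ) / (k + l : ℝ) : ℝ) * τ.quad u v)

/-! ### Convergence -/

lemma exists_quad_im_ge (τ : TorusForm) :
    ∃ ε : ℝ, 0 < ε ∧ ∀ u v : ℝ, ε * (u ^ 2 + v ^ 2) ≤ (τ.quad u v).im := by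
  obtain ⟨t1, t2, t3, h1, h2⟩ := τ
  have him : ∀ u v : ℝ, ((⟨t1, t2, t3, h1, h2⟩ : TorusForm).quad u v).im
      = t1.im * u ^ 2 + t2.im * v ^ 2 + 2 * t3.im * u * v := by
    intro u v
    simp [quad, pow_two]
  have h2p : 0 < t2.im := by
    by_contra hc
    push Not at hc
    nlinarith [sq_nonneg t3.im]
  have htr : 0 < t1.im + t2.im := by linarith
  set ε := (t1.im * t2.im - t3.im ^ 2) / (t1.im + t2.im) with hε
  have hεp : 0 < ε := div_pos h2 htr
  have hεe : ε * (t1.im + t2.im) = t1.im * t2.im - t3.im ^ 2 := by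
    rw [hε]; field_simp
  refine ⟨ε, hεp, fun u v => ?_⟩
  rw [him]
  have hA : 0 < t1.im - ε := by
    by_contra hc
    push Not at hc
    nlinarith [sq_nonneg t3.im]
  have key : (t1.im - ε) * (t1.im * u ^ 2 + t2.im * v ^ 2 + 2 * t3.im * u * v
      - ε * (u ^ 2 + v ^ 2)) = ((t1.im - ε) * u + t3.im * v) ^ 2 + ε ^ 2 * v ^ 2 := by
    linear_combination (-v ^ 2) * hεe
  have : 0 ≤ t1.im * u ^ 2 + t2.im * v ^ 2 + 2 * t3.im * u * v - ε * (u ^ 2 + v ^ 2) := by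
    by_contra hc
    push Not at hc
    nlinarith [mul_neg_of_pos_of_neg hA hc, sq_nonneg ((t1.im - ε) * u + t3.im * v),
      mul_nonneg (sq_nonneg ε) (sq_nonneg v)]
  linarith

/-- The Gaussian `exp (-δ (u² + v²))`. -/
def gauss (δ u v : ℝ) : ℝ := Real.exp (-δ * (u ^ 2 + v ^ 2))

lemma gauss_nonneg (δ u v : ℝ) : 0 ≤ gauss δ u v := (Real.exp_pos _).le

lemma gauss_sum_one {δ : ℝ} (hδ : 0 < δ) : ∃ C : ℝ, ∀ u : ℝ,
    Summable (fun n : ℤ => Real.exp (-δ * (n + u) ^ 2)) ∧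
      ∑' n : ℤ, Real.exp (-δ * (n + u) ^ 2) ≤ C := by
  have hs : Summable (fun n : ℤ => Real.exp δ * Real.exp (-(δ / 2) * (n : ℝ) ^ 2)) := by
    have h := (summable_jacobiTheta₂_term_iff 0 (((δ / (2 * Real.pi) : ℝ) : ℂ) * I)).2
      (by rw [Complex.im_ofReal_mul]; simp only [I_im, mul_one]; positivity)
    have h' := h.norm
    simp only [norm_jacobiTheta₂_term] at h'
    refine (h'.congr fun n => ?_).mul_left _
    congr 1
    have := Real.pi_ne_zero
    simp only [Complex.im_ofReal_mul, I_im, Complex.zero_im]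
    field_simp
    ring
  have key : ∀ u : ℝ, 0 ≤ u → u < 1 →
      ∀ n : ℤ, Real.exp (-δ * (n + u) ^ 2) ≤ Real.exp δ * Real.exp (-(δ / 2) * (n : ℝ) ^ 2) := by
    intro u h0 h1 n
    rw [← Real.exp_add]
    apply Real.exp_le_exp.2
    nlinarith [mul_nonneg hδ.le (sq_nonneg ((n : ℝ) + 2 * u)),
      mul_nonneg hδ.le (show 0 ≤ 1 - u ^ 2 by nlinarith)]
  refine ⟨∑' n : ℤ, Real.exp δ * Real.exp (-(δ / 2) * (n : ℝ) ^ 2), fun u => ?_⟩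
  have hk := key (Int.fract u) (Int.fract_nonneg u) (Int.fract_lt_one u)
  have hs1 : Summable (fun n : ℤ => Real.exp (-δ * (n + Int.fract u) ^ 2)) :=
    Summable.of_nonneg_of_le (fun _ => (Real.exp_pos _).le) hk hs
  have he : (fun n : ℤ => Real.exp (-δ * (n + u) ^ 2))
      = (fun n : ℤ => Real.exp (-δ * (n + Int.fract u) ^ 2)) ∘ (Equiv.addRight ⌊u⌋) := by
    funext n
    simp only [Function.comp, Equiv.coe_addRight]
    congr 3
    push_cast
    have := Int.floor_add_fract u
    linarith
  rw [he]
  refine ⟨(Equiv.summable_iff _).2 hs1, ?_⟩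
  rw [show (∑' n : ℤ, ((fun n : ℤ => Real.exp (-δ * (n + Int.fract u) ^ 2)) ∘
    (Equiv.addRight ⌊u⌋)) n) = _ from
      Equiv.tsum_eq (Equiv.addRight ⌊u⌋) (fun n : ℤ => Real.exp (-δ * (n + Int.fract u) ^ 2))]
  exact hs1.tsum_le_tsum hk hs

lemma gauss_sum {δ : ℝ} (hδ : 0 < δ) : ∃ C : ℝ, ∀ u v : ℝ,
    Summable (fun n : ℤ × ℤ => gauss δ (n.1 + u) (n.2 + v)) ∧
      ∑' n : ℤ × ℤ, gauss δ (n.1 + u) (n.2 + v) ≤ C := by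
  obtain ⟨C, hC⟩ := gauss_sum_one hδ
  have hC0 : 0 ≤ C := le_trans (tsum_nonneg fun _ => (Real.exp_pos _).le) (hC 0).2
  refine ⟨C * C, fun u v => ?_⟩
  have he : (fun n : ℤ × ℤ => gauss δ (n.1 + u) (n.2 + v)) = fun n : ℤ × ℤ =>
      Real.exp (-δ * (n.1 + u) ^ 2) * Real.exp (-δ * (n.2 + v) ^ 2) := by
    funext n
    rw [gauss, ← Real.exp_add]
    congr 1
    ring
  rw [he]
  have hs := (hC u).1.mul_of_nonneg (hC v).1 (fun _ => (Real.exp_pos _).le)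
    (fun _ => (Real.exp_pos _).le)
  refine ⟨hs, ?_⟩
  rw [← (hC u).1.tsum_mul_tsum (hC v).1 hs]
  exact mul_le_mul (hC u).2 (hC v).2 (tsum_nonneg fun _ => (Real.exp_pos _).le) hC0

lemma triangleWeight_norm_le (τ : TorusForm) (k l : ℕ+) :
    ∃ δ : ℝ, 0 < δ ∧ ∀ u v : ℝ, ‖τ.triangleWeight k l u v‖ ≤ gauss δ u v := by
  obtain ⟨ε, hε, h⟩ := τ.exists_quad_im_ge
  have hk : (0 : ℝ) < (k : ℕ) := by exact_mod_cast k.pos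
  have hl : (0 : ℝ) < (l : ℕ) := by exact_mod_cast l.pos
  set c : ℝ := (3 * (k : ℕ) * (l : ℕ) : ℝ) / ((k : ℕ) + (l : ℕ) : ℝ) with hc
  have hcp : 0 < c := by positivity
  refine ⟨Real.pi * c * ε, by positivity, fun u v => ?_⟩
  rw [triangleWeight, Complex.norm_exp, gauss]
  apply Real.exp_le_exp.2
  rw [← hc]
  have : (Real.pi * I * (c : ℂ) * τ.quad u v).re = -(Real.pi * c * (τ.quad u v).im) := by
    rw [show (Real.pi * I * (c : ℂ) * τ.quad u v) = ((Real.pi * c : ℝ) : ℂ) * (I * τ.quad u v) by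
      push_cast; ring, Complex.re_ofReal_mul]
    simp
  rw [this]
  have := mul_le_mul_of_nonneg_left (h u v) (show 0 ≤ Real.pi * c by positivity)
  linarith

end TorusForm

/-- Sums over `ℤ²` split according to residue classes modulo `M`. -/
lemma tsum_int_sq_split (M : ℕ) (hM : 0 < M) (g : ℤ × ℤ → ℂ) (hg : Summable g) :
    ∑' n, g n = ∑ i ∈ Finset.range M ×ˢ Finset.range M,
      ∑' m : ℤ × ℤ, g (M * m.1 + i.1, M * m.2 + i.2) := by
  have : NeZero M := ⟨hM.ne'⟩
  let e : (Fin M × Fin M) × (ℤ × ℤ) ≃ ℤ × ℤ :=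
    ((Equiv.prodComm _ _).trans (Equiv.prodProdProdComm ℤ ℤ (Fin M) (Fin M))).trans
      (Equiv.prodCongr (Int.divModEquiv M).symm (Int.divModEquiv M).symm)
  have he : ∀ p, e p = ((M : ℤ) * p.2.1 + (p.1.1 : ℕ), (M : ℤ) * p.2.2 + (p.1.2 : ℕ)) := by
    intro p
    simp [e, Int.divModEquiv, mul_comm]
  have hge : Summable (g ∘ e) := (Equiv.summable_iff e).2 hg
  rw [← Equiv.tsum_eq e g]
  rw [show (∑' c, g (e c)) = ∑' c, (g ∘ e) c from rfl, hge.tsum_prod, tsum_fintype]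
  rw [Finset.sum_product, Fintype.sum_prod_type, Finset.sum_range]
  refine Finset.sum_congr rfl fun i _ => ?_
  rw [Finset.sum_range]
  refine Finset.sum_congr rfl fun j _ => ?_
  refine tsum_congr fun m => ?_
  simp only [Function.comp, he]

/-! ### The symplectomorphism and the intersection points -/

/-- The affine symplectomorphism `ρ(x₁, x₂, y₁, y₂) = (x₁ + b₁, x₂ + b₂, y₁ + 3 x₁, y₂ + 3 x₂)` of
the universal cover `ℝ⁴` of `T`, with `ℝ⁴` written as pairs `((x₁, x₂), (y₁, y₂))`. -/
def rho (b₁ b₂ : ℝ) (p : (ℝ × ℝ) × (ℝ × ℝ)) : (ℝ × ℝ) × (ℝ × ℝ) :=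
  ((p.1.1 + b₁, p.1.2 + b₂), (p.2.1 + 3 * p.1.1, p.2.2 + 3 * p.1.2))

/-- The `x_i`-coordinate `a / (3l) + (l + 1) b / 2` of the intersection point of
`L = {y = 0}` and `ρ^l L` labelled by `a`. -/
def pointCoord (l : ℕ) (a : ℤ) (b : ℝ) : ℝ := a / (3 * l) + (l + 1) / 2 * b

lemma rho_iterate (b₁ b₂ : ℝ) (l : ℕ) (x₁ x₂ : ℝ) :
    (rho b₁ b₂)^[l] ((x₁, x₂), (0, 0)) =
      ((x₁ + l * b₁, x₂ + l * b₂),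
        (3 * l * x₁ + 3 * (l * (l - 1) / 2) * b₁, 3 * l * x₂ + 3 * (l * (l - 1) / 2) * b₂)) := by
  induction l with
  | zero => simp
  | succ n ih =>
    rw [Function.iterate_succ_apply', ih]
    simp only [rho, Prod.mk.injEq]
    push_cast
    refine ⟨⟨?_, ?_⟩, ?_, ?_⟩ <;> ring

/-- The points of `ρ^l L` lying over `pointCoord l a b` have integral `y`-coordinates `(a₁, a₂)`, so
that in `T = ℝ⁴/ℤ⁴` they lie on `L = {y = 0}`. -/
lemma rho_iterate_pointCoord (b₁ b₂ : ℝ) (l : ℕ) (hl : 0 < l) (a₁ a₂ : ℤ) :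
    (rho b₁ b₂)^[l] ((pointCoord l a₁ b₁ - l * b₁, pointCoord l a₂ b₂ - l * b₂), (0, 0)) =
      ((pointCoord l a₁ b₁, pointCoord l a₂ b₂), ((a₁ : ℝ), (a₂ : ℝ))) := by
  have : (l : ℝ) ≠ 0 := by exact_mod_cast hl.ne'
  rw [rho_iterate]
  simp only [pointCoord, Prod.mk.injEq]
  refine ⟨⟨?_, ?_⟩, ?_, ?_⟩ <;> field_simp <;> ring

/-! ### The ring `R(T)` -/

/-- The basis of `R(T) = ⨁ Hom(L, ρ^l L)`: the unit in degree `0`, and in each degree `l ≥ 1` the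
intersection points of `L` and `ρ^l L`, labelled by `(ℤ/3l)²`. -/
inductive Generator : Type
  | one : Generator
  | point (l : ℕ+) (a₁ a₂ : ZMod (3 * (l : ℕ))) : Generator

namespace Generator

/-- The degree of a basis element. -/
def degree : Generator → ℕ
  | one => 0
  | point l _ _ => l

/-- The basis element of degree `l` labelled by the classes of two integers modulo `3l`. -/
def ofInt (l : ℕ+) (a₁ a₂ : ℤ) : Generator := point l a₁ a₂

lemma ofInt_congr {l l' : ℕ+} {a₁ a₂ a₁' a₂' : ℤ} (h : l = l')
    (h₁ : ∃ s : ℤ, a₁ = a₁' + 3 * l * s) (h₂ : ∃ s : ℤ, a₂ = a₂' + 3 * l * s) :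
    ofInt l a₁ a₂ = ofInt l' a₁' a₂' := by
  subst h
  obtain ⟨s, rfl⟩ := h₁
  obtain ⟨t, rfl⟩ := h₂
  have h0 : (3 : ZMod (3 * (l : ℕ))) * ((l : ℕ) : ZMod (3 * (l : ℕ))) = 0 := by
    have := ZMod.natCast_self (3 * (l : ℕ))
    push_cast at this
    exact this
  simp only [ofInt, point.injEq, heq_eq_eq, true_and]
  push_cast
  constructor <;> rw [h0] <;> ring

end Generator

/-- The underlying vector space of `R(T)`, for the form `τ` and the translation vector
`(b₁, b₂)`. -/
def FukayaRing (_τ : TorusForm) (_b₁ _b₂ : ℝ) : Type := Generator →₀ ℂ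

namespace FukayaRing

variable {τ : TorusForm} {b₁ b₂ : ℝ}

instance : AddCommGroup (FukayaRing τ b₁ b₂) := inferInstanceAs (AddCommGroup (Generator →₀ ℂ))

instance : Module ℂ (FukayaRing τ b₁ b₂) := inferInstanceAs (Module ℂ (Generator →₀ ℂ))

variable (τ b₁ b₂)

/-- A basis element, as an element of `R(T)`. -/
def basis (g : Generator) : FukayaRing τ b₁ b₂ := Finsupp.single g (1 : ℂ)

/-- The element `Y^l_{a₁,a₂}` of `R(T)`. -/
def Y (l : ℕ+) (a₁ a₂ : ℤ) : FukayaRing τ b₁ b₂ := basis τ b₁ b₂ (Generator.ofInt l a₁ a₂)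

/-- The product
`Y^k_{a} Y^l_{c} = ∑_{i,j ∈ ℤ/(k+l)} θ_{k,l}(k c - l a + 3kl (i,j), b) Y^{k+l}_{a + c + 3l (i,j)}`. -/
def mulPoint (k l : ℕ+) (a₁ a₂ c₁ c₂ : ℤ) : FukayaRing τ b₁ b₂ :=
  ∑ i ∈ Finset.range (k + l) ×ˢ Finset.range (k + l),
    τ.thetaKL (k * c₁ - l * a₁ + 3 * k * l * i.1) (k * c₂ - l * a₂ + 3 * k * l * i.2) b₁ b₂ k l •
      Y τ b₁ b₂ (k + l) (a₁ + c₁ + 3 * l * i.1) (a₂ + c₂ + 3 * l * i.2)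

/-- The product of two basis elements. -/
def mulBasis : Generator → Generator → FukayaRing τ b₁ b₂
  | .one, h => basis τ b₁ b₂ h
  | g, .one => basis τ b₁ b₂ g
  | .point k a₁ a₂, .point l c₁ c₂ =>
      mulPoint τ b₁ b₂ k l (a₁.val : ℤ) (a₂.val : ℤ) (c₁.val : ℤ) (c₂.val : ℤ)

/-- The linear map out of `R(T)` with prescribed values on the basis. -/
def lift {M : Type*} [AddCommGroup M] [Module ℂ M] (f : Generator → M) :
    FukayaRing τ b₁ b₂ →ₗ[ℂ] M :=
  (Finsupp.linearCombination ℂ f : (Generator →₀ ℂ) →ₗ[ℂ] M)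

lemma lift_basis {M : Type*} [AddCommGroup M] [Module ℂ M] (f : Generator → M) (g : Generator) :
    lift τ b₁ b₂ f (basis τ b₁ b₂ g) = f g :=
  (Finsupp.linearCombination_single ℂ (1 : ℂ) g).trans (one_smul ℂ (f g))

/-- The product of `R(T)` as a bilinear map: the bilinear extension of `mulBasis`. -/
def mulLin : FukayaRing τ b₁ b₂ →ₗ[ℂ] FukayaRing τ b₁ b₂ →ₗ[ℂ] FukayaRing τ b₁ b₂ :=
  lift τ b₁ b₂ fun g => lift τ b₁ b₂ (mulBasis τ b₁ b₂ g)

instance : Mul (FukayaRing τ b₁ b₂) := ⟨fun x y => mulLin τ b₁ b₂ x y⟩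

instance : One (FukayaRing τ b₁ b₂) := ⟨basis τ b₁ b₂ .one⟩

/-! #### The ring axioms -/

lemma mul_def (x y : FukayaRing τ b₁ b₂) : x * y = mulLin τ b₁ b₂ x y := rfl

lemma one_def : (1 : FukayaRing τ b₁ b₂) = basis τ b₁ b₂ .one := rfl

lemma basis_mul_basis (g h : Generator) :
    basis τ b₁ b₂ g * basis τ b₁ b₂ h = mulBasis τ b₁ b₂ g h := by
  rw [mul_def, mulLin, lift_basis, lift_basis]

variable {τ b₁ b₂}

lemma induction_basis {p : FukayaRing τ b₁ b₂ → Prop} (x : FukayaRing τ b₁ b₂) (h0 : p 0)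
    (hadd : ∀ x y, p x → p y → p (x + y)) (hsmul : ∀ (c : ℂ) (g : Generator),
      p (c • basis τ b₁ b₂ g)) : p x := by
  refine Finsupp.induction_linear (motive := p) x h0 hadd fun g c => ?_
  have := hsmul c g
  have h : c • basis τ b₁ b₂ g = Finsupp.single g c := by
    rw [basis]
    exact (Finsupp.smul_single _ _ _).trans (by simp)
  rwa [h] at this

/-- Linear maps out of `R(T)` that agree on the basis are equal. -/
lemma hom_ext {M : Type*} [AddCommGroup M] [Module ℂ M] {f g : FukayaRing τ b₁ b₂ →ₗ[ℂ] M}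
    (h : ∀ x, f (basis τ b₁ b₂ x) = g (basis τ b₁ b₂ x)) : f = g := by
  ext x
  induction x using induction_basis with
  | h0 => simp
  | hadd x y hx hy => simp [hx, hy]
  | hsmul c x => simp [h]

/-- Elements of `R(T)` are separated by linear functionals. -/
lemma ext_functional {x y : FukayaRing τ b₁ b₂}
    (h : ∀ F : FukayaRing τ b₁ b₂ →ₗ[ℂ] ℂ, F x = F y) : x = y := by
  refine Finsupp.ext fun g => ?_
  exact h (Finsupp.lapply g)

lemma Y_congr {l l' : ℕ+} {a₁ a₂ a₁' a₂' : ℤ} (h : l = l')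
    (h₁ : ∃ s : ℤ, a₁ = a₁' + 3 * l * s) (h₂ : ∃ s : ℤ, a₂ = a₂' + 3 * l * s) :
    Y τ b₁ b₂ l a₁ a₂ = Y τ b₁ b₂ l' a₁' a₂' := by
  rw [Y, Y, Generator.ofInt_congr h h₁ h₂]

lemma exists_functional_Y_le (F : FukayaRing τ b₁ b₂ →ₗ[ℂ] ℂ) (l : ℕ+) :
    ∃ B : ℝ, 0 ≤ B ∧ ∀ a₁ a₂ : ℤ, ‖F (Y τ b₁ b₂ l a₁ a₂)‖ ≤ B := by
  have : NeZero (3 * (l : ℕ)) := ⟨by have := l.pos; omega⟩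
  refine ⟨∑ a : ZMod (3 * (l : ℕ)) × ZMod (3 * (l : ℕ)),
    ‖F (basis τ b₁ b₂ (.point l a.1 a.2))‖, Finset.sum_nonneg fun _ _ => norm_nonneg _,
    fun a₁ a₂ => ?_⟩
  exact Finset.single_le_sum (f := fun a : ZMod (3 * (l : ℕ)) × ZMod (3 * (l : ℕ)) =>
    ‖F (basis τ b₁ b₂ (.point l a.1 a.2))‖) (fun _ _ => norm_nonneg _)
    (Finset.mem_univ ((a₁ : ZMod (3 * (l : ℕ))), (a₂ : ZMod (3 * (l : ℕ)))))

/-- The displacement between the vertices of the `n`-th triangle that contributes to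
`Y^k_a Y^l_c`. -/
def disp (k l : ℕ) (a c : ℤ) (b : ℝ) (n : ℤ) : ℝ :=
  (pointCoord l c b + k * b + n) - pointCoord k a b

lemma summable_triangles (F : FukayaRing τ b₁ b₂ →ₗ[ℂ] ℂ) (k l j : ℕ+) (u v : ℝ)
    (f : ℤ × ℤ → ℤ × ℤ) :
    Summable fun n : ℤ × ℤ => τ.triangleWeight k l (n.1 + u) (n.2 + v) *
      F (Y τ b₁ b₂ j (f n).1 (f n).2) := by
  obtain ⟨δ, hδ, hw⟩ := τ.triangleWeight_norm_le k l
  obtain ⟨C, hC⟩ := TorusForm.gauss_sum hδ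
  obtain ⟨B, hB0, hB⟩ := exists_functional_Y_le F j
  refine Summable.of_norm_bounded ((hC u v).1.mul_right B) fun n => ?_
  rw [norm_mul]
  exact mul_le_mul (hw _ _) (hB _ _) (norm_nonneg _) (TorusForm.gauss_nonneg _ _ _)

lemma disp_eq (k l : ℕ) (a c : ℤ) (b : ℝ) (n : ℤ) : disp k l a c b n = n + disp k l a c b 0 := by
  simp only [disp]
  push_cast
  ring

/-- The product is the sum over all triangles with the prescribed vertices, each weighted by
the exponential of its symplectic area. -/
lemma functional_mulPoint (F : FukayaRing τ b₁ b₂ →ₗ[ℂ] ℂ) (k l : ℕ+) (a₁ a₂ c₁ c₂ : ℤ) :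
    F (mulPoint τ b₁ b₂ k l a₁ a₂ c₁ c₂) = ∑' n : ℤ × ℤ,
      τ.triangleWeight k l (disp k l a₁ c₁ b₁ n.1) (disp k l a₂ c₂ b₂ n.2) *
        F (Y τ b₁ b₂ (k + l) (a₁ + c₁ + 3 * l * n.1) (a₂ + c₂ + 3 * l * n.2)) := by
  have hs : Summable fun n : ℤ × ℤ =>
      τ.triangleWeight k l (disp k l a₁ c₁ b₁ n.1) (disp k l a₂ c₂ b₂ n.2) *
        F (Y τ b₁ b₂ (k + l) (a₁ + c₁ + 3 * l * n.1) (a₂ + c₂ + 3 * l * n.2)) := by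
    have := summable_triangles F k l (k + l) (disp k l a₁ c₁ b₁ 0) (disp k l a₂ c₂ b₂ 0)
      (fun n => (a₁ + c₁ + 3 * l * n.1, a₂ + c₂ + 3 * l * n.2))
    simp only [← disp_eq] at this
    exact this
  rw [tsum_int_sq_split (k + l) (by have := k.pos; omega) _ hs, mulPoint, map_sum]
  refine Finset.sum_congr rfl fun i _ => ?_
  rw [map_smul, smul_eq_mul, TorusForm.thetaKL, ← tsum_mul_right]
  refine tsum_congr fun m => ?_
  have hk : ((k : ℕ) : ℝ) ≠ 0 := by exact_mod_cast k.ne_zero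
  have hl : ((l : ℕ) : ℝ) ≠ 0 := by exact_mod_cast l.ne_zero
  have hkl : ((k : ℕ) + (l : ℕ) : ℝ) ≠ 0 := by
    have := k.pos
    positivity
  congr 1
  · rw [TorusForm.triangleWeight]
    congr 1
    have e : ∀ (a c m i : ℤ) (b : ℝ),
        disp k l a c b ((((k : ℕ) + (l : ℕ) : ℕ) : ℤ) * m + i) = ((k : ℕ) + (l : ℕ) : ℝ) *
        (m + ((k * c - l * a + 3 * k * l * i : ℤ) : ℝ) / ((3 * k * l * (k + l) : ℕ) : ℝ)
          + b / 2) := by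
      intro a c m i b
      simp only [disp, pointCoord]
      push_cast
      field_simp
      ring
    rw [e a₁ c₁ m.1 i.1, e a₂ c₂ m.2 i.2]
    have q : ∀ s u v : ℝ, τ.quad (s * u) (s * v) = (s : ℂ) ^ 2 * τ.quad u v := by
      intro s u v
      simp only [TorusForm.quad]
      push_cast
      ring
    rw [q]
    generalize τ.quad _ _ = Q
    have hkl' : ((k : ℕ) + (l : ℕ) : ℂ) ≠ 0 := by exact_mod_cast hkl
    push_cast
    field_simp
  · congr 1
    refine Y_congr rfl ⟨-(l * m.1), ?_⟩ ⟨-(l * m.2), ?_⟩ <;> (push_cast; ring)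

lemma disp_shift (k l : ℕ+) (a c s t n : ℤ) (b : ℝ) :
    disp k l (a + 3 * k * s) (c + 3 * l * t) b (n + s - t) = disp k l a c b n := by
  have hk : ((k : ℕ) : ℝ) ≠ 0 := by exact_mod_cast k.ne_zero
  have hl : ((l : ℕ) : ℝ) ≠ 0 := by exact_mod_cast l.ne_zero
  simp only [disp, pointCoord]
  push_cast
  field_simp
  ring

lemma mulPoint_shift (k l : ℕ+) (a₁ a₂ c₁ c₂ s₁ s₂ t₁ t₂ : ℤ) :
    mulPoint τ b₁ b₂ k l (a₁ + 3 * k * s₁) (a₂ + 3 * k * s₂) (c₁ + 3 * l * t₁) (c₂ + 3 * l * t₂) =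
      mulPoint τ b₁ b₂ k l a₁ a₂ c₁ c₂ := by
  refine ext_functional fun F => ?_
  rw [functional_mulPoint, functional_mulPoint,
    ← Equiv.tsum_eq ((Equiv.addRight (s₁ - t₁)).prodCongr (Equiv.addRight (s₂ - t₂)))]
  refine tsum_congr fun n => ?_
  simp only [Equiv.prodCongr_apply, Prod.map_fst, Prod.map_snd, Equiv.coe_addRight,
    ← add_sub_assoc]
  rw [disp_shift, disp_shift]
  congr 2
  refine Y_congr rfl ⟨s₁, ?_⟩ ⟨s₂, ?_⟩ <;> (push_cast; ring)

lemma exists_val_eq (l : ℕ+) (a : ℤ) :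
    ∃ s : ℤ, (((a : ZMod (3 * (l : ℕ))).val : ℕ) : ℤ) = a + 3 * l * s := by
  have : NeZero (3 * (l : ℕ)) := ⟨by have := l.pos; omega⟩
  refine ⟨-(a / (3 * (l : ℕ) : ℕ)), ?_⟩
  rw [ZMod.val_intCast]
  have := Int.emod_add_mul_ediv a (3 * (l : ℕ) : ℕ)
  push_cast at this ⊢
  linarith

lemma Y_mul_Y (k l : ℕ+) (a₁ a₂ c₁ c₂ : ℤ) :
    Y τ b₁ b₂ k a₁ a₂ * Y τ b₁ b₂ l c₁ c₂ = mulPoint τ b₁ b₂ k l a₁ a₂ c₁ c₂ := by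
  rw [Y, Y, basis_mul_basis, Generator.ofInt, Generator.ofInt, mulBasis]
  obtain ⟨s₁, h₁⟩ := exists_val_eq k a₁
  obtain ⟨s₂, h₂⟩ := exists_val_eq k a₂
  obtain ⟨t₁, h₃⟩ := exists_val_eq l c₁
  obtain ⟨t₂, h₄⟩ := exists_val_eq l c₂
  rw [h₁, h₂, h₃, h₄, mulPoint_shift]

lemma basis_point (l : ℕ+) (a₁ a₂ : ZMod (3 * (l : ℕ))) :
    basis τ b₁ b₂ (.point l a₁ a₂) = Y τ b₁ b₂ l a₁.val a₂.val := by
  have : NeZero (3 * (l : ℕ)) := ⟨by have := l.pos; omega⟩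
  rw [Y, Generator.ofInt]
  congr 2 <;> simp

lemma disp_left (k l j : ℕ+) (a c e : ℤ) (b : ℝ) (n n' : ℤ) :
    disp l j c e b (n' - n) = disp (k + l : ℕ) j (a + c + 3 * l * n) e b n' -
      (k : ℕ) / ((k : ℕ) + (l : ℕ)) * disp k l a c b n := by
  have hk : ((k : ℕ) : ℝ) ≠ 0 := by exact_mod_cast k.ne_zero
  have hl : ((l : ℕ) : ℝ) ≠ 0 := by exact_mod_cast l.ne_zero
  have hj : ((j : ℕ) : ℝ) ≠ 0 := by exact_mod_cast j.ne_zero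
  have hkl : ((k : ℕ) + (l : ℕ) : ℝ) ≠ 0 := by
    have := k.pos
    positivity
  simp only [disp, pointCoord]
  push_cast
  field_simp
  ring

lemma disp_right (k l j : ℕ+) (a c e : ℤ) (b : ℝ) (n n' : ℤ) :
    disp k (l + j : ℕ) a (c + e + 3 * j * (n' - n)) b n = disp k l a c b n +
      (j : ℕ) / ((l : ℕ) + (j : ℕ)) * disp l j c e b (n' - n) := by
  have hk : ((k : ℕ) : ℝ) ≠ 0 := by exact_mod_cast k.ne_zero
  have hl : ((l : ℕ) : ℝ) ≠ 0 := by exact_mod_cast l.ne_zero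
  have hj : ((j : ℕ) : ℝ) ≠ 0 := by exact_mod_cast j.ne_zero
  have hlj : ((l : ℕ) + (j : ℕ) : ℝ) ≠ 0 := by
    have := l.pos
    positivity
  simp only [disp, pointCoord]
  push_cast
  field_simp
  ring

/-- Two decompositions of a quadrilateral into two triangles have the same total area. -/
lemma weight_cocycle (k l j : ℕ+) (u₁ u₂ v₁ v₂ u₁' u₂' v₁' v₂' : ℝ)
    (hv₁ : v₁' = v₁ - (k : ℕ) / ((k : ℕ) + (l : ℕ)) * u₁)
    (hv₂ : v₂' = v₂ - (k : ℕ) / ((k : ℕ) + (l : ℕ)) * u₂)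
    (hu₁ : u₁' = u₁ + (j : ℕ) / ((l : ℕ) + (j : ℕ)) * v₁')
    (hu₂ : u₂' = u₂ + (j : ℕ) / ((l : ℕ) + (j : ℕ)) * v₂') :
    τ.triangleWeight k l u₁ u₂ * τ.triangleWeight (k + l : ℕ) j v₁ v₂ =
      τ.triangleWeight l j v₁' v₂' * τ.triangleWeight k (l + j : ℕ) u₁' u₂' := by
  subst hu₁ hu₂ hv₁ hv₂
  have hkl : ((k : ℕ) + (l : ℕ) : ℂ) ≠ 0 := by exact_mod_cast (k + l).ne_zero
  have hlj : ((l : ℕ) + (j : ℕ) : ℂ) ≠ 0 := by exact_mod_cast (l + j).ne_zero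
  have hklj : ((k : ℕ) + (l : ℕ) + (j : ℕ) : ℂ) ≠ 0 := by exact_mod_cast (k + l + j).ne_zero
  have hklj' : ((k : ℕ) + ((l : ℕ) + (j : ℕ)) : ℂ) ≠ 0 := by rwa [← add_assoc]
  simp only [TorusForm.triangleWeight, ← Complex.exp_add, TorusForm.quad]
  congr 1
  push_cast
  field_simp
  ring

lemma summable_prod_of_le {ι κ : Type*} (a : ι → ℝ) (b : ι → κ → ℝ) (C : ℝ) (ha : ∀ i, 0 ≤ a i)
    (hb : ∀ i j, 0 ≤ b i j) (hsa : Summable a) (hsb : ∀ i, Summable (b i))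
    (hC : ∀ i, ∑' j, b i j ≤ C) : Summable fun p : ι × κ => a p.1 * b p.1 p.2 := by
  have h0 : (0 : ι × κ → ℝ) ≤ fun p : ι × κ => a p.1 * b p.1 p.2 :=
    fun p => mul_nonneg (ha _) (hb _ _)
  refine (summable_prod_of_nonneg h0).2 ⟨fun i => (hsb i).mul_left (a i), ?_⟩
  have h1 : ∀ i, ∑' j, a i * b i j ≤ a i * C := fun i => by
    rw [tsum_mul_left]
    exact mul_le_mul_of_nonneg_left (hC i) (ha i)
  have h2 : ∀ i, 0 ≤ ∑' j, a i * b i j := fun i =>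
    tsum_nonneg fun j => mul_nonneg (ha i) (hb i j)
  exact Summable.of_nonneg_of_le h2 h1 (hsa.mul_right C)

lemma summable_double (F : FukayaRing τ b₁ b₂ →ₗ[ℂ] ℂ) (k l k' l' j : ℕ+) (u₁ u₂ : ℝ)
    (v₁ v₂ : ℤ × ℤ → ℝ) (f : (ℤ × ℤ) × (ℤ × ℤ) → ℤ × ℤ) :
    Summable fun p : (ℤ × ℤ) × (ℤ × ℤ) =>
      τ.triangleWeight k l (p.1.1 + u₁) (p.1.2 + u₂) *
        (τ.triangleWeight k' l' (p.2.1 + v₁ p.1) (p.2.2 + v₂ p.1) *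
          F (Y τ b₁ b₂ j (f p).1 (f p).2)) := by
  obtain ⟨δ, hδ, hw⟩ := τ.triangleWeight_norm_le k l
  obtain ⟨δ', hδ', hw'⟩ := τ.triangleWeight_norm_le k' l'
  obtain ⟨C, hC⟩ := TorusForm.gauss_sum hδ
  obtain ⟨C', hC'⟩ := TorusForm.gauss_sum hδ'
  obtain ⟨B, hB0, hB⟩ := exists_functional_Y_le F j
  have hGs := summable_prod_of_le (fun n : ℤ × ℤ => TorusForm.gauss δ (n.1 + u₁) (n.2 + u₂))
    (fun n n' : ℤ × ℤ => TorusForm.gauss δ' (n'.1 + v₁ n) (n'.2 + v₂ n) * B) (C' * B)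
    (fun _ => TorusForm.gauss_nonneg _ _ _)
    (fun _ _ => mul_nonneg (TorusForm.gauss_nonneg _ _ _) hB0) (hC u₁ u₂).1
    (fun n => (hC' (v₁ n) (v₂ n)).1.mul_right B)
    (fun n => by
      rw [tsum_mul_right]
      exact mul_le_mul_of_nonneg_right (hC' (v₁ n) (v₂ n)).2 hB0)
  refine Summable.of_norm_bounded hGs fun p => ?_
  rw [norm_mul, norm_mul]
  exact mul_le_mul (hw _ _) (mul_le_mul (hw' _ _) (hB _ _) (norm_nonneg _)
    (TorusForm.gauss_nonneg _ _ _)) (by positivity) (TorusForm.gauss_nonneg _ _ _)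

lemma Y_mul_assoc (k l j : ℕ+) (a₁ a₂ c₁ c₂ e₁ e₂ : ℤ) :
    Y τ b₁ b₂ k a₁ a₂ * Y τ b₁ b₂ l c₁ c₂ * Y τ b₁ b₂ j e₁ e₂ =
      Y τ b₁ b₂ k a₁ a₂ * (Y τ b₁ b₂ l c₁ c₂ * Y τ b₁ b₂ j e₁ e₂) := by
  refine ext_functional fun F => ?_
  have hL := functional_mulPoint (F ∘ₗ (mulLin τ b₁ b₂).flip (Y τ b₁ b₂ j e₁ e₂)) k l a₁ a₂ c₁ c₂
  have hR := functional_mulPoint (F ∘ₗ mulLin τ b₁ b₂ (Y τ b₁ b₂ k a₁ a₂)) l j c₁ c₂ e₁ e₂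
  simp only [LinearMap.comp_apply, LinearMap.flip_apply, ← mul_def, ← Y_mul_Y] at hL hR
  rw [hL, hR]
  clear hL hR
  simp only [Y_mul_Y, functional_mulPoint, ← tsum_mul_left]
  set g : (ℤ × ℤ) × (ℤ × ℤ) → ℂ := fun p =>
    τ.triangleWeight l j (disp l j c₁ e₁ b₁ p.1.1) (disp l j c₂ e₂ b₂ p.1.2) *
      (τ.triangleWeight k (l + j : ℕ+) (disp k (l + j : ℕ+) a₁ (c₁ + e₁ + 3 * j * p.1.1) b₁ p.2.1)
        (disp k (l + j : ℕ+) a₂ (c₂ + e₂ + 3 * j * p.1.2) b₂ p.2.2) *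
      F (Y τ b₁ b₂ (k + (l + j)) (a₁ + (c₁ + e₁ + 3 * j * p.1.1) + 3 * (l + j : ℕ+) * p.2.1)
        (a₂ + (c₂ + e₂ + 3 * j * p.1.2) + 3 * (l + j : ℕ+) * p.2.2))) with hg
  set f : (ℤ × ℤ) × (ℤ × ℤ) → ℂ := fun p =>
    τ.triangleWeight k l (disp k l a₁ c₁ b₁ p.1.1) (disp k l a₂ c₂ b₂ p.1.2) *
      (τ.triangleWeight (k + l : ℕ+) j (disp (k + l : ℕ+) j (a₁ + c₁ + 3 * l * p.1.1) e₁ b₁ p.2.1)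
        (disp (k + l : ℕ+) j (a₂ + c₂ + 3 * l * p.1.2) e₂ b₂ p.2.2) *
      F (Y τ b₁ b₂ (k + l + j) (a₁ + c₁ + 3 * l * p.1.1 + e₁ + 3 * j * p.2.1)
        (a₂ + c₂ + 3 * l * p.1.2 + e₂ + 3 * j * p.2.2))) with hf
  let E : (ℤ × ℤ) × (ℤ × ℤ) ≃ (ℤ × ℤ) × (ℤ × ℤ) :=
    { toFun := fun p => (p.2 - p.1, p.1)
      invFun := fun p => (p.2, p.1 + p.2)
      left_inv := fun p => by ext <;> simp
      right_inv := fun p => by ext <;> simp }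
  have hfg : ∀ p, f p = g (E p) := by
    rintro ⟨n, n'⟩
    simp only [hf, hg, E, Equiv.coe_fn_mk, Prod.fst_sub, Prod.snd_sub, PNat.add_coe]
    rw [← mul_assoc, ← mul_assoc, weight_cocycle k l j _ _ _ _ _ _ _ _
      (disp_left k l j a₁ c₁ e₁ b₁ n.1 n'.1) (disp_left k l j a₂ c₂ e₂ b₂ n.2 n'.2)
      (disp_right k l j a₁ c₁ e₁ b₁ n.1 n'.1) (disp_right k l j a₂ c₂ e₂ b₂ n.2 n'.2)]
    congr 2
    refine Y_congr (add_assoc _ _ _) ⟨0, ?_⟩ ⟨0, ?_⟩ <;> (push_cast; ring)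
  have hsf : Summable f := by
    have := summable_double F k l (k + l) j (k + l + j) (disp k l a₁ c₁ b₁ 0) (disp k l a₂ c₂ b₂ 0)
      (fun n => disp (k + l : ℕ+) j (a₁ + c₁ + 3 * l * n.1) e₁ b₁ 0)
      (fun n => disp (k + l : ℕ+) j (a₂ + c₂ + 3 * l * n.2) e₂ b₂ 0)
      (fun p => (a₁ + c₁ + 3 * l * p.1.1 + e₁ + 3 * j * p.2.1,
        a₂ + c₂ + 3 * l * p.1.2 + e₂ + 3 * j * p.2.2))
    simp only [← disp_eq] at this
    exact this
  have hfg' : f = g ∘ E := funext hfg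
  have hsg : Summable g := by
    rw [hfg', Equiv.summable_iff] at hsf
    exact hsf
  calc _ = ∑' p, f p := (hsf.tsum_prod).symm
    _ = ∑' p, g p := by rw [hfg']; exact Equiv.tsum_eq E g
    _ = _ := hsg.tsum_prod

lemma one_mul_aux (x : FukayaRing τ b₁ b₂) : 1 * x = x := by
  have : mulLin τ b₁ b₂ 1 = LinearMap.id := by
    refine hom_ext fun g => ?_
    rw [← mul_def, one_def, basis_mul_basis]
    rfl
  rw [mul_def, this, LinearMap.id_apply]

lemma mul_one_aux (x : FukayaRing τ b₁ b₂) : x * 1 = x := by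
  have : (mulLin τ b₁ b₂).flip 1 = LinearMap.id := by
    refine hom_ext fun g => ?_
    rw [LinearMap.flip_apply, ← mul_def, one_def, basis_mul_basis]
    cases g <;> rfl
  rw [mul_def, ← LinearMap.flip_apply, this, LinearMap.id_apply]

lemma basis_mul_assoc (g h t : Generator) :
    basis τ b₁ b₂ g * basis τ b₁ b₂ h * basis τ b₁ b₂ t =
      basis τ b₁ b₂ g * (basis τ b₁ b₂ h * basis τ b₁ b₂ t) := by
  cases g with
  | one => rw [← one_def, one_mul_aux, one_mul_aux]
  | point k a₁ a₂ =>
    cases h with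
    | one => rw [← one_def, mul_one_aux, one_mul_aux]
    | point l c₁ c₂ =>
      cases t with
      | one => rw [← one_def, mul_one_aux, mul_one_aux]
      | point j e₁ e₂ => simp only [basis_point, Y_mul_assoc]

lemma mul_assoc_aux (x y z : FukayaRing τ b₁ b₂) : x * y * z = x * (y * z) := by
  simp only [mul_def]
  induction x using induction_basis with
  | h0 => simp
  | hadd x x' hx hx' => simp only [map_add, LinearMap.add_apply, hx, hx']
  | hsmul s g =>
    induction y using induction_basis with
    | h0 => simp
    | hadd y y' hy hy' => simp only [map_add, LinearMap.add_apply, hy, hy']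
    | hsmul s' h =>
      induction z using induction_basis with
      | h0 => simp
      | hadd z z' hz hz' => simp only [map_add, hz, hz']
      | hsmul s'' t =>
        have := basis_mul_assoc (τ := τ) (b₁ := b₁) (b₂ := b₂) g h t
        simp only [mul_def] at this
        simp only [map_smul, LinearMap.smul_apply, this]

instance : Ring (FukayaRing τ b₁ b₂) :=
  { (inferInstance : AddCommGroup (FukayaRing τ b₁ b₂)) with
    mul := fun x y => x * y
    one := 1
    left_distrib := fun x y z => map_add (mulLin τ b₁ b₂ x) y z
    right_distrib := fun x y z => by
      change mulLin τ b₁ b₂ (x + y) z = mulLin τ b₁ b₂ x z + mulLin τ b₁ b₂ y z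
      rw [map_add, LinearMap.add_apply]
    zero_mul := fun x => by
      change mulLin τ b₁ b₂ 0 x = 0
      rw [map_zero, LinearMap.zero_apply]
    mul_zero := fun x => map_zero (mulLin τ b₁ b₂ x)
    mul_assoc := mul_assoc_aux
    one_mul := one_mul_aux
    mul_one := mul_one_aux }

instance : Algebra ℂ (FukayaRing τ b₁ b₂) :=
  Algebra.ofModule
    (fun r x y => by
      change mulLin τ b₁ b₂ (r • x) y = r • mulLin τ b₁ b₂ x y
      rw [map_smul, LinearMap.smul_apply])
    (fun r x y => map_smul (mulLin τ b₁ b₂ x) r y)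

/-- In equal degrees the product is
`Y^l_a Y^l_c = ∑_{i,j ∈ ℤ/2} θ(c - a + 3l (i,j), l b, l) Y^{2l}_{a + c + 3l (i,j)}`. -/
lemma Y_mul_Y_same (l : ℕ+) (a₁ a₂ c₁ c₂ : ℤ) :
    Y τ b₁ b₂ l a₁ a₂ * Y τ b₁ b₂ l c₁ c₂ =
      ∑ i ∈ Finset.range 2 ×ˢ Finset.range 2,
        τ.theta (c₁ - a₁ + 3 * i.1 * l) (c₂ - a₂ + 3 * i.2 * l) (l * b₁) (l * b₂) l •
          Y τ b₁ b₂ (l + l) (a₁ + c₁ + 3 * l * i.1) (a₂ + c₂ + 3 * l * i.2) := by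
  refine ext_functional fun F => ?_
  have hs : Summable fun n : ℤ × ℤ =>
      τ.triangleWeight l l (disp l l a₁ c₁ b₁ n.1) (disp l l a₂ c₂ b₂ n.2) *
        F (Y τ b₁ b₂ (l + l) (a₁ + c₁ + 3 * l * n.1) (a₂ + c₂ + 3 * l * n.2)) := by
    have := summable_triangles F l l (l + l) (disp l l a₁ c₁ b₁ 0) (disp l l a₂ c₂ b₂ 0)
      (fun n => (a₁ + c₁ + 3 * l * n.1, a₂ + c₂ + 3 * l * n.2))
    simp only [← disp_eq] at this
    exact this
  rw [Y_mul_Y, functional_mulPoint, tsum_int_sq_split 2 (by norm_num) _ hs, map_sum]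
  refine Finset.sum_congr rfl fun i _ => ?_
  rw [map_smul, smul_eq_mul, TorusForm.theta, ← tsum_mul_right]
  refine tsum_congr fun m => ?_
  have hl : ((l : ℕ) : ℂ) ≠ 0 := by exact_mod_cast l.ne_zero
  congr 1
  · rw [TorusForm.triangleWeight, ← Complex.exp_add, ← Complex.exp_add]
    congr 1
    simp only [TorusForm.quad, disp, pointCoord]
    push_cast
    field_simp
    ring
  · congr 1
    refine Y_congr rfl ⟨m.1, ?_⟩ ⟨m.2, ?_⟩ <;> (push_cast; ring)

/-! #### The grading -/

variable (τ b₁ b₂)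

/-- The degree `n` part `Hom(L, ρ^n L)` of `R(T)`, spanned by the basis elements of degree `n`. -/
def grading (n : ℕ) : Submodule ℂ (FukayaRing τ b₁ b₂) :=
  Submodule.span ℂ (basis τ b₁ b₂ '' {g | g.degree = n})

lemma basis_mem (g : Generator) : basis τ b₁ b₂ g ∈ grading τ b₁ b₂ g.degree :=
  Submodule.subset_span ⟨g, rfl, rfl⟩

lemma Y_mem (l : ℕ+) (a₁ a₂ : ℤ) : Y τ b₁ b₂ l a₁ a₂ ∈ grading τ b₁ b₂ l :=
  basis_mem τ b₁ b₂ (Generator.ofInt l a₁ a₂)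

lemma mulBasis_mem (g h : Generator) :
    mulBasis τ b₁ b₂ g h ∈ grading τ b₁ b₂ (g.degree + h.degree) := by
  cases g with
  | one =>
    rw [show Generator.one.degree + h.degree = h.degree from Nat.zero_add _]
    exact basis_mem τ b₁ b₂ h
  | point k a₁ a₂ =>
    cases h with
    | one => exact basis_mem τ b₁ b₂ (.point k a₁ a₂)
    | point l c₁ c₂ =>
      exact Submodule.sum_mem _ fun i _ => Submodule.smul_mem _ _ (Y_mem τ b₁ b₂ (k + l) _ _)

instance : SetLike.GradedMonoid (grading τ b₁ b₂) where
  one_mem := basis_mem τ b₁ b₂ .one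
  mul_mem := by
    intro i j x y hx hy
    have key : ∀ g : Generator, g.degree = i →
        basis τ b₁ b₂ g * y ∈ grading τ b₁ b₂ (i + j) := by
      rintro g rfl
      induction hy using Submodule.span_induction with
      | mem y hy =>
        obtain ⟨h, rfl, rfl⟩ := hy
        rw [basis_mul_basis]
        exact mulBasis_mem τ b₁ b₂ g h
      | zero => rw [mul_zero]; exact Submodule.zero_mem _
      | add y z _ _ hy hz => rw [mul_add]; exact Submodule.add_mem _ hy hz
      | smul c y _ hy => rw [mul_smul_comm]; exact Submodule.smul_mem _ _ hy
    induction hx using Submodule.span_induction with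
    | mem x hx =>
      obtain ⟨g, hg, rfl⟩ := hx
      exact key g hg
    | zero => rw [zero_mul]; exact Submodule.zero_mem _
    | add x z _ _ hx hz => rw [add_mul]; exact Submodule.add_mem _ hx hz
    | smul c x _ hx => rw [smul_mul_assoc]; exact Submodule.smul_mem _ _ hx

instance : GradedAlgebra (grading τ b₁ b₂) :=
  { (inferInstance : SetLike.GradedMonoid (grading τ b₁ b₂)),
    DirectSum.Decomposition.ofLinearMap (grading τ b₁ b₂)
      (lift τ b₁ b₂ fun g => DirectSum.lof ℂ ℕ (fun n => grading τ b₁ b₂ n) g.degree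
        ⟨basis τ b₁ b₂ g, basis_mem τ b₁ b₂ g⟩)
      (by
        refine hom_ext fun g => ?_
        rw [LinearMap.comp_apply, lift_basis, DirectSum.coeLinearMap_lof, LinearMap.id_apply])
      (by
        refine DirectSum.linearMap_ext _ fun n => ?_
        ext ⟨x, hx⟩ : 1
        simp only [LinearMap.comp_apply, DirectSum.coeLinearMap_lof, LinearMap.id_apply]
        induction hx using Submodule.span_induction with
        | mem x hx =>
          obtain ⟨g, rfl, rfl⟩ := hx
          rw [lift_basis]
        | zero => rw [map_zero]; exact (map_zero _).symm
        | add x y hx' hy' hx hy =>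
          rw [map_add, hx, hy, ← map_add]
          rfl
        | smul c x hx' hx =>
          rw [map_smul, hx, ← map_smul]
          rfl) with }

/-- The generator `Z_{ij} = Y^1_{i,j}` of degree one, for `i, j ∈ ℤ/3`. -/
def Z (i j : ZMod 3) : FukayaRing τ b₁ b₂ := Y τ b₁ b₂ 1 (i.val : ℤ) (j.val : ℤ)

variable {τ b₁ b₂}

/-- When its product is commutative, `R(T)` is a commutative ring. -/
abbrev commRing (h : ∀ x y : FukayaRing τ b₁ b₂, x * y = y * x) :
    CommRing (FukayaRing τ b₁ b₂) :=
  { (inferInstance : Ring (FukayaRing τ b₁ b₂)) with mul_comm := h }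

end FukayaRing

attribute [local instance] MvPolynomial.gradedAlgebra

/-- The structure morphism to `Spec ℂ` of the projective spectrum of a graded `ℂ`-algebra. -/
def projStructureMap {A : Type} [CommRing A] [Algebra ℂ A] (𝒜 : ℕ → Submodule ℂ A)
    [GradedAlgebra 𝒜] :
    AlgebraicGeometry.Proj 𝒜 ⟶ AlgebraicGeometry.Spec (CommRingCat.of ℂ) :=
  CategoryTheory.CategoryStruct.comp (AlgebraicGeometry.Proj.toSpecZero 𝒜)
    (AlgebraicGeometry.Spec.map (CommRingCat.ofHom (algebraMap ℂ (𝒜 0))))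

/-- The degree grading of the polynomial ring `ℂ[Z_{ij}]`, `i, j ∈ ℤ/3`.  Its projective spectrum
is `ℙ⁸`. -/
abbrev polyGrading : ℕ → Submodule ℂ (MvPolynomial (ZMod 3 × ZMod 3) ℂ) :=
  MvPolynomial.homogeneousSubmodule (ZMod 3 × ZMod 3) ℂ

/-- Projective space `ℙ⁸` over `ℂ`, with homogeneous coordinates `Z_{ij}`. -/
abbrev P8 : AlgebraicGeometry.Scheme := AlgebraicGeometry.Proj polyGrading

/-- The mirror of `T`: the projective spectrum of `R(T)`, when `R(T)` is commutative. -/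
abbrev mirror {τ : TorusForm} {b₁ b₂ : ℝ} (h : ∀ x y : FukayaRing τ b₁ b₂, x * y = y * x) :
    AlgebraicGeometry.Scheme :=
  letI := FukayaRing.commRing h
  AlgebraicGeometry.Proj (FukayaRing.grading τ b₁ b₂)

end

/-! The symmetry of `theta` and commutativity both come from evenness of the quadratic form. A
reflection of the summation lattice negates the displacement and preserves the weight. For the
product, this reflection involves a translation by `(k + l) b`, which preserves `ℤ²` because `b` is
integral.

The core is generation in degree one, proved by duality: a functional `F` on the part of degree `n =
l + 1` that kills every product of degrees `1` and `l` must vanish. Put `M = 3l` and `lam e = F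
(Y^{n}_e)`, which is periodic modulo `3n`. With `c = r + l a`, the vanishing of `F (Y^1_a Y^l_c)`
says that a Gaussian times the translate of `lam` by `n a` has sum zero over the class of `r` modulo
`M`. A discrete Fourier transform in `a` over `(ℤ/3)²` replaces `lam` by nine functions `μ`, each
multiplied by a character under translation by `nℤ²`. The Gaussian times `μ` is then the coefficient
family of a theta function of level `n`, and the class sums vanish exactly when this function
vanishes on `(1/M)ℤ²`.

Such a function is zero as soon as `n < M` (`TorusForm.eq_zero_of_tsum_class_eq_zero`). Multiply it
by an auxiliary theta function of level `k = M - n`. The product has level `M`, so on each class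
modulo `M` its coefficients are one unknown times an explicit theta series, and it still vanishes on
`(1/M)ℤ²`. A generic translate of the auxiliary factor makes these finitely many theta values
nonzero, so the product vanishes identically; the auxiliary factor can also be kept nonzero at any
prescribed point, so the original function vanishes there. Here `n < M` reads `l + 1 < 3l`, which
holds for all `l ≥ 1`. Fourier inversion over `(ℤ/3)²` then gives `lam = 0`
(`FukayaRing.functional_eq_zero`), and induction on the degree gives generation
(`FukayaRing.eq_top_of_Y_one_mem`).

Finally, a surjection of graded algebras is surjective on the degree-zero localizations, hence
induces a closed immersion of projective spectra. -/

noncomputable section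

open Complex

/-! ### Fourier series on `ℤ²` -/

/-- The character `a ↦ exp (2πi (a₁ u₁ + a₂ u₂))` of `ℤ²`. -/
def latticeChar (u : ℝ × ℝ) (a : ℤ × ℤ) : ℂ :=
  cexp (2 * Real.pi * I * (a.1 * u.1 + a.2 * u.2))

lemma latticeChar_add (u : ℝ × ℝ) (a b : ℤ × ℤ) :
    latticeChar u (a + b) = latticeChar u a * latticeChar u b := by
  rw [latticeChar, latticeChar, latticeChar, ← Complex.exp_add]
  congr 1
  simp only [Prod.fst_add, Prod.snd_add]
  push_cast
  ring

lemma latticeChar_add_left (u v : ℝ × ℝ) (a : ℤ × ℤ) :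
    latticeChar (u + v) a = latticeChar u a * latticeChar v a := by
  rw [latticeChar, latticeChar, latticeChar, ← Complex.exp_add]
  congr 1
  simp only [Prod.fst_add, Prod.snd_add]
  push_cast
  ring

lemma latticeChar_ne_zero (u : ℝ × ℝ) (a : ℤ × ℤ) : latticeChar u a ≠ 0 := Complex.exp_ne_zero _

lemma norm_latticeChar (u : ℝ × ℝ) (a : ℤ × ℤ) : ‖latticeChar u a‖ = 1 := by
  rw [latticeChar, show (2 * Real.pi * I * (a.1 * u.1 + a.2 * u.2) : ℂ) =
    ((2 * Real.pi * (a.1 * u.1 + a.2 * u.2) : ℝ) : ℂ) * I by push_cast; ring,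
    Complex.norm_exp_ofReal_mul_I]

lemma sum_range_exp (M : ℕ) (hM : 0 < M) (x : ℤ) :
    ∑ r ∈ Finset.range M, cexp (2 * Real.pi * I * (x * (r / M))) =
      if (M : ℤ) ∣ x then (M : ℂ) else 0 := by
  have hM' : (M : ℂ) ≠ 0 := by exact_mod_cast hM.ne'
  set ζ : ℂ := cexp (2 * Real.pi * I * (x / M)) with hζ
  have h1 : ∀ r ∈ Finset.range M, cexp (2 * Real.pi * I * (x * (r / M))) = ζ ^ r := by
    intro r _
    rw [hζ, ← Complex.exp_nat_mul]
    congr 1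
    ring
  rw [Finset.sum_congr rfl h1]
  have hiff : ζ = 1 ↔ (M : ℤ) ∣ x := by
    rw [hζ, Complex.exp_eq_one_iff]
    constructor
    · rintro ⟨n, hn⟩
      refine ⟨n, ?_⟩
      have : (x : ℂ) / M = n := by
        have h2 := Complex.two_pi_I_ne_zero
        apply mul_left_cancel₀ h2
        rw [hn]; ring
      rw [div_eq_iff hM'] at this
      have : (x : ℂ) = ((M * n : ℤ) : ℂ) := by rw [this]; push_cast; ring
      exact_mod_cast this
    · rintro ⟨n, rfl⟩
      refine ⟨n, ?_⟩
      push_cast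
      field_simp
  split_ifs with h
  · rw [hiff.2 h]; simp
  · have hne : ζ ≠ 1 := fun h' => h (hiff.1 h')
    rw [geom_sum_eq hne]
    have : ζ ^ M = 1 := by
      rw [hζ, ← Complex.exp_nat_mul, Complex.exp_eq_one_iff]
      exact ⟨x, by field_simp⟩
    rw [this]; simp

/-- Orthogonality relations on `(ℤ/M)²`. -/
lemma sum_latticeChar (M : ℕ) (hM : 0 < M) (a : ℤ × ℤ) :
    ∑ r ∈ Finset.range M ×ˢ Finset.range M, latticeChar ((r.1 : ℝ) / M, (r.2 : ℝ) / M) a =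
      if (M : ℤ) ∣ a.1 ∧ (M : ℤ) ∣ a.2 then (M : ℂ) ^ 2 else 0 := by
  have : ∀ r : ℕ × ℕ, latticeChar ((r.1 : ℝ) / M, (r.2 : ℝ) / M) a =
      cexp (2 * Real.pi * I * (a.1 * (r.1 / M))) * cexp (2 * Real.pi * I * (a.2 * (r.2 / M))) := by
    intro r
    rw [latticeChar, ← Complex.exp_add]
    congr 1
    push_cast
    ring
  simp only [this]
  rw [Finset.sum_product]
  simp only [← Finset.mul_sum, sum_range_exp M hM]
  rw [← Finset.sum_mul, sum_range_exp M hM]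
  split_ifs <;> simp_all [pow_two]

/-- The Fourier series with coefficients `a`. -/
def fourierSum (a : ℤ × ℤ → ℂ) (u : ℝ × ℝ) : ℂ := ∑' k, a k * latticeChar u k

lemma Summable.mul_latticeChar {a : ℤ × ℤ → ℂ} (ha : Summable a) (u : ℝ × ℝ) :
    Summable fun k => a k * latticeChar u k := by
  refine Summable.of_norm_bounded ha.norm fun k => ?_
  rw [norm_mul, norm_latticeChar, mul_one]

/-- Averaging the series over the grid `(1/M)ℤ²` keeps exactly the coefficients on `Mℤ²`, so these
sum to zero for every `M`. As `M → ∞`, dominated convergence leaves only the coefficient at the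
origin. This avoids integration over the torus. -/
lemma eq_zero_at_zero_of_fourierSum_eq_zero {a : ℤ × ℤ → ℂ} (ha : Summable a)
    (h : ∀ u, fourierSum a u = 0) : a 0 = 0 := by
  have h1 : ∀ M : ℕ, 0 < M →
      ∑' k : ℤ × ℤ, (if (M : ℤ) ∣ k.1 ∧ (M : ℤ) ∣ k.2 then a k else 0) = 0 := by
    intro M hM
    have hM' : (M : ℂ) ≠ 0 := by exact_mod_cast hM.ne'
    have h2 : ∑ r ∈ Finset.range M ×ˢ Finset.range M,
        fourierSum a ((r.1 : ℝ) / M, (r.2 : ℝ) / M) = 0 :=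
      Finset.sum_eq_zero fun r _ => h _
    simp only [fourierSum] at h2
    rw [← Summable.tsum_finsetSum fun r _ => ha.mul_latticeChar _] at h2
    simp only [← Finset.mul_sum, sum_latticeChar M hM] at h2
    have h3 : ∀ k : ℤ × ℤ, (a k * if (M : ℤ) ∣ k.1 ∧ (M : ℤ) ∣ k.2 then (M : ℂ) ^ 2 else 0) =
        (if (M : ℤ) ∣ k.1 ∧ (M : ℤ) ∣ k.2 then a k else 0) * (M : ℂ) ^ 2 := by
      intro k; split_ifs <;> simp
    simp only [h3, tsum_mul_right] at h2
    exact (mul_eq_zero.1 h2).resolve_right (pow_ne_zero _ hM')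
  have h2 : Filter.Tendsto
      (fun M : ℕ => ∑' k : ℤ × ℤ, (if (M : ℤ) ∣ k.1 ∧ (M : ℤ) ∣ k.2 then a k else 0))
      Filter.atTop (nhds (∑' k : ℤ × ℤ, if k = 0 then a 0 else 0)) := by
    refine tendsto_tsum_of_dominated_convergence ha.norm ?_ ?_
    · intro k
      apply tendsto_const_nhds.congr'
      filter_upwards [Filter.eventually_gt_atTop (max k.1.natAbs k.2.natAbs)] with M hM
      have hM1 : k.1.natAbs < M := lt_of_le_of_lt (le_max_left _ _) hM
      have hM2 : k.2.natAbs < M := lt_of_le_of_lt (le_max_right _ _) hM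
      have : ((M : ℤ) ∣ k.1 ∧ (M : ℤ) ∣ k.2) ↔ k = 0 := by
        constructor
        · rintro ⟨h1, h2⟩
          exact Prod.ext (Int.eq_zero_of_dvd_of_natAbs_lt_natAbs h1 (by simpa using hM1))
            (Int.eq_zero_of_dvd_of_natAbs_lt_natAbs h2 (by simpa using hM2))
        · rintro rfl; simp
      simp only [this]
      split_ifs with hk
      · rw [hk]
      · rfl
    · refine Filter.Eventually.of_forall fun M k => ?_
      split_ifs <;> simp
  rw [tsum_ite_eq] at h2
  refine tendsto_nhds_unique h2 (tendsto_const_nhds.congr' ?_)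
  filter_upwards [Filter.eventually_gt_atTop 0] with M hM
  rw [h1 M hM]

lemma fourierSum_shift {a : ℤ × ℤ → ℂ} (j : ℤ × ℤ) (u : ℝ × ℝ) :
    fourierSum (fun k => a (k + j)) u * latticeChar u j = fourierSum a u := by
  rw [fourierSum, fourierSum, ← tsum_mul_right,
    ← Equiv.tsum_eq (Equiv.addRight j) fun k => a k * latticeChar u k]
  refine tsum_congr fun k => ?_
  rw [Equiv.coe_addRight, latticeChar_add, mul_assoc]

/-- A summable family is determined by its Fourier series. -/
lemma eq_zero_of_fourierSum_eq_zero {a : ℤ × ℤ → ℂ} (ha : Summable a)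
    (h : ∀ u, fourierSum a u = 0) (j : ℤ × ℤ) : a j = 0 := by
  have h1 := eq_zero_at_zero_of_fourierSum_eq_zero (a := fun k => a (k + j))
    ((Equiv.summable_iff (Equiv.addRight j)).2 ha) fun u =>
      (mul_eq_zero.1 ((fourierSum_shift j u).trans (h u))).resolve_right (latticeChar_ne_zero _ _)
  simpa using h1

/-! ### Rapidly decaying coefficients and generic nonvanishing -/

/-- Families on `ℤ²` that decay faster than every exponential. -/
def RapidDecay (a : ℤ × ℤ → ℂ) : Prop :=
  ∀ B : ℝ, Summable fun k : ℤ × ℤ => ‖a k‖ * Real.exp (B * (|(k.1 : ℝ)| + |(k.2 : ℝ)|))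

namespace RapidDecay

lemma summable_norm {a : ℤ × ℤ → ℂ} (ha : RapidDecay a) : Summable fun k => ‖a k‖ := by
  simpa using ha 0

lemma of_norm_le {a b : ℤ × ℤ → ℂ} (ha : RapidDecay a) (C : ℝ) (h : ∀ k, ‖b k‖ ≤ C * ‖a k‖) :
    RapidDecay b := fun B => by
  refine Summable.of_nonneg_of_le (fun k => by positivity) (fun k => ?_) ((ha B).mul_left C)
  rw [← mul_assoc]
  exact mul_le_mul_of_nonneg_right (h k) (Real.exp_pos _).le

lemma mul_latticeChar {a : ℤ × ℤ → ℂ} (ha : RapidDecay a) (u : ℝ × ℝ) :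
    RapidDecay fun k => a k * latticeChar u k :=
  ha.of_norm_le 1 fun k => by rw [norm_mul, norm_latticeChar]; simp

/-- Half of the Gaussian absorbs any exponential of `|k.1| + |k.2|`, and the other half is summable.
-/
lemma of_gauss {a : ℤ × ℤ → ℂ} {δ C A : ℝ} (hδ : 0 < δ)
    (h : ∀ k, ‖a k‖ ≤ C * (TorusForm.gauss δ k.1 k.2 *
      Real.exp (A * (|(k.1 : ℝ)| + |(k.2 : ℝ)|)))) : RapidDecay a := fun B => by
  obtain ⟨_, hC'⟩ := TorusForm.gauss_sum (half_pos hδ)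
  have hs := (hC' 0 0).1
  simp only [add_zero] at hs
  have hC : 0 ≤ C := by
    have := (norm_nonneg _).trans (h 0)
    by_contra hc
    push Not at hc
    have h2 : 0 < (TorusForm.gauss δ ((0 : ℤ × ℤ).1 : ℝ) ((0 : ℤ × ℤ).2 : ℝ) *
      Real.exp (A * (|((0 : ℤ × ℤ).1 : ℝ)| + |((0 : ℤ × ℤ).2 : ℝ)|))) :=
      mul_pos (Real.exp_pos _) (Real.exp_pos _)
    nlinarith
  refine Summable.of_nonneg_of_le (fun k => by positivity) (fun k => ?_)
    (hs.mul_left (C * Real.exp ((A + B) ^ 2 / δ)))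
  refine (mul_le_mul_of_nonneg_right (h k) (Real.exp_pos _).le).trans ?_
  rw [mul_assoc, mul_assoc C]
  refine mul_le_mul_of_nonneg_left ?_ hC
  rw [TorusForm.gauss, TorusForm.gauss, ← Real.exp_add, ← Real.exp_add, ← Real.exp_add]
  apply Real.exp_le_exp.2
  -- Completing the square; using this in both coordinates produces the constant `exp ((A + B)² /
  -- δ)`.
  have key : ∀ x : ℝ, (A + B) * |x| ≤ δ / 2 * x ^ 2 + (A + B) ^ 2 / (2 * δ) := by
    intro x
    have h1 : δ / 2 * x ^ 2 + (A + B) ^ 2 / (2 * δ) - (A + B) * |x| =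
        (δ * |x| - (A + B)) ^ 2 / (2 * δ) := by
      rw [← sq_abs x]
      field_simp
      ring
    have h2 : 0 ≤ (δ * |x| - (A + B)) ^ 2 / (2 * δ) := by positivity
    linarith
  have h1 := key k.1
  have h2 := key k.2
  have h3 : (A + B) ^ 2 / (2 * δ) + (A + B) ^ 2 / (2 * δ) = (A + B) ^ 2 / δ := by
    field_simp; ring
  nlinarith

lemma continuous_fourierSum {a : ℤ × ℤ → ℂ} (ha : RapidDecay a) :
    Continuous (fourierSum a) := by
  refine continuous_tsum (fun k => ?_) ha.summable_norm fun k u => ?_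
  · unfold latticeChar
    fun_prop
  · rw [norm_mul, norm_latticeChar, mul_one]

/-- On lines, Fourier series with rapidly decaying coefficients extend to entire functions. -/
lemma exists_entire {a : ℤ × ℤ → ℂ} (ha : RapidDecay a) (u v : ℝ × ℝ) :
    ∃ f : ℂ → ℂ, Differentiable ℂ f ∧ ∀ t : ℝ, f t = fourierSum a (u + t • v) := by
  refine ⟨fun t => ∑' k : ℤ × ℤ, a k * latticeChar u k *
    cexp (2 * Real.pi * I * t * (k.1 * v.1 + k.2 * v.2)), ?_, fun t => ?_⟩
  · intro t₀
    -- On the ball of radius `R` the exponential in `t` is at most `exp (B (|k.1| + |k.2|))`. Since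
    -- `R`, and with it `B`, is unbounded, decay against every exponential is needed.
    set R : ℝ := ‖t₀‖ + 1
    set B : ℝ := 2 * Real.pi * R * max |v.1| |v.2|
    have hd : DifferentiableOn ℂ (fun t : ℂ => ∑' k : ℤ × ℤ, a k * latticeChar u k *
        cexp (2 * Real.pi * I * t * (k.1 * v.1 + k.2 * v.2))) (Metric.ball 0 R) := by
      refine differentiableOn_tsum_of_summable_norm (ha B) (fun k => ?_) Metric.isOpen_ball
        fun k t ht => ?_
      · exact Differentiable.differentiableOn (by fun_prop)
      · rw [norm_mul, norm_mul, norm_latticeChar, mul_one, Complex.norm_exp]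
        refine mul_le_mul_of_nonneg_left (Real.exp_le_exp.2 ?_) (norm_nonneg _)
        refine (Complex.re_le_norm _).trans ?_
        have hk : ‖(k.1 * v.1 + k.2 * v.2 : ℂ)‖ ≤
            max |v.1| |v.2| * (|(k.1 : ℝ)| + |(k.2 : ℝ)|) := by
          rw [show (k.1 * v.1 + k.2 * v.2 : ℂ) = ((k.1 * v.1 + k.2 * v.2 : ℝ) : ℂ) by
            push_cast; ring,
            Complex.norm_real, Real.norm_eq_abs]
          refine (abs_add_le _ _).trans ?_
          rw [abs_mul, abs_mul, mul_add, mul_comm |(k.1 : ℝ)|, mul_comm |(k.2 : ℝ)|]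
          exact add_le_add (mul_le_mul_of_nonneg_right (le_max_left _ _) (abs_nonneg _))
            (mul_le_mul_of_nonneg_right (le_max_right _ _) (abs_nonneg _))
        have ht' : ‖t‖ ≤ R := by
          have := Metric.mem_ball.1 ht
          rw [dist_zero_right] at this
          exact this.le
        rw [norm_mul, norm_mul]
        have h2 : ‖(2 * Real.pi * I : ℂ)‖ = 2 * Real.pi := by
          simp [abs_of_pos Real.pi_pos]
        rw [h2]
        calc 2 * Real.pi * ‖t‖ * ‖(k.1 * v.1 + k.2 * v.2 : ℂ)‖
            ≤ 2 * Real.pi * R * (max |v.1| |v.2| * (|(k.1 : ℝ)| + |(k.2 : ℝ)|)) := by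
              have := Real.pi_pos
              gcongr
          _ = _ := by simp only [B]; ring
    refine hd.differentiableAt (Metric.isOpen_ball.mem_nhds ?_)
    simp [R]
  · refine tsum_congr fun k => ?_
    rw [latticeChar_add_left, mul_assoc]
    congr 2
    rw [latticeChar]
    congr 1
    simp only [Prod.smul_fst, Prod.smul_snd, smul_eq_mul]
    push_cast
    ring

/-- The Fourier series of a nonzero rapidly decaying family is nonzero on a dense set. -/
lemma dense_fourierSum_ne_zero {a : ℤ × ℤ → ℂ} (ha : RapidDecay a) {j : ℤ × ℤ} (hj : a j ≠ 0) :
    Dense {u | fourierSum a u ≠ 0} := by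
  obtain ⟨u', hu'⟩ : ∃ u', fourierSum a u' ≠ 0 := by
    by_contra hc
    push Not at hc
    exact hj (eq_zero_of_fourierSum_eq_zero ha.summable_norm.of_norm hc j)
  intro u
  -- On the line from `u` to `u'` the series is entire and nonzero at `t = 1`, so its zeros are
  -- isolated: small nonzero real `t` give nonvanishing points arbitrarily close to `u`.
  obtain ⟨f, hf, hfu⟩ := ha.exists_entire u (u' - u)
  have hA : AnalyticOnNhd ℂ f Set.univ := fun z _ => hf.analyticAt z
  have hev : ∀ᶠ z in nhdsWithin (0 : ℂ) {0}ᶜ, f z ≠ 0 := by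
    rcases (hA 0 trivial).eventually_eq_zero_or_eventually_ne_zero with h | h
    · exfalso
      have h1 := hA.eqOn_zero_of_preconnected_of_eventuallyEq_zero isPreconnected_univ trivial h
        (Set.mem_univ 1)
      have h2 := hfu 1
      rw [Complex.ofReal_one] at h2
      simp only [h1, one_smul, add_sub_cancel] at h2
      exact hu' h2.symm
    · exact h
  have ht : Filter.Tendsto (fun t : ℝ => (t : ℂ)) (nhdsWithin 0 {0}ᶜ)
      (nhdsWithin (0 : ℂ) {0}ᶜ) := by
    refine tendsto_nhdsWithin_of_tendsto_nhds_of_eventually_within _ ?_ ?_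
    · exact (Complex.continuous_ofReal.tendsto' 0 0 (by simp)).mono_left nhdsWithin_le_nhds
    · filter_upwards [self_mem_nhdsWithin] with t ht
      simpa using ht
  have hev' := ht.eventually hev
  have hc : Filter.Tendsto (fun t : ℝ => u + t • (u' - u)) (nhdsWithin 0 {0}ᶜ) (nhds u) := by
    have : Continuous fun t : ℝ => u + t • (u' - u) := by fun_prop
    exact (this.tendsto' 0 u (by simp)).mono_left nhdsWithin_le_nhds
  refine mem_closure_of_tendsto hc ?_
  filter_upwards [hev'] with t ht'
  rw [hfu] at ht'
  exact ht'

/-- Finitely many Fourier series of nonzero rapidly decaying families are simultaneously nonzero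
at some point. -/
lemma exists_forall_fourierSum_ne_zero {ι : Type*} (s : Finset ι) (a : ι → ℤ × ℤ → ℂ)
    (ha : ∀ i, RapidDecay (a i)) (j : ι → ℤ × ℤ) (hj : ∀ i, a i (j i) ≠ 0) :
    ∃ u, ∀ i ∈ s, fourierSum (a i) u ≠ 0 := by
  classical
  -- Openness is carried through the induction because two dense sets need not meet in a dense set.
  have : Dense {u | ∀ i ∈ s, fourierSum (a i) u ≠ 0} ∧
      IsOpen {u | ∀ i ∈ s, fourierSum (a i) u ≠ 0} := by
    induction s using Finset.induction_on with
    | empty => simp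
    | insert i s _ ih =>
      have ho : IsOpen {u | fourierSum (a i) u ≠ 0} :=
        isOpen_ne_fun (ha i).continuous_fourierSum continuous_const
      have he : {u | ∀ i' ∈ insert i s, fourierSum (a i') u ≠ 0} =
          {u | fourierSum (a i) u ≠ 0} ∩ {u | ∀ i ∈ s, fourierSum (a i) u ≠ 0} := by
        ext u; simp
      rw [he]
      exact ⟨((ha i).dense_fourierSum_ne_zero (hj i)).inter_of_isOpen_left ih.1 ho,
        ho.inter ih.2⟩
  exact this.1.nonempty

end RapidDecay

/-! ### Convolution -/

/-- The convolution of two families on `ℤ²`. -/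
def latticeConv (f g : ℤ × ℤ → ℂ) (t : ℤ × ℤ) : ℂ := ∑' s, f s * g (t - s)

lemma summable_conv_aux {f g : ℤ × ℤ → ℂ} (hf : Summable fun k => ‖f k‖)
    (hg : Summable fun k => ‖g k‖) :
    Summable fun p : (ℤ × ℤ) × (ℤ × ℤ) => f p.2 * g (p.1 - p.2) := by
  let e : (ℤ × ℤ) × (ℤ × ℤ) ≃ (ℤ × ℤ) × (ℤ × ℤ) :=
    { toFun := fun p => (p.2, p.1 - p.2)
      invFun := fun p => (p.1 + p.2, p.1)
      left_inv := fun p => by ext <;> simp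
      right_inv := fun p => by ext <;> simp }
  exact (Equiv.summable_iff e).2 (summable_mul_of_summable_norm hf hg)

lemma tsum_latticeConv {f g : ℤ × ℤ → ℂ} (hf : Summable fun k => ‖f k‖)
    (hg : Summable fun k => ‖g k‖) : ∑' t, latticeConv f g t = (∑' k, f k) * ∑' k, g k := by
  let e : (ℤ × ℤ) × (ℤ × ℤ) ≃ (ℤ × ℤ) × (ℤ × ℤ) :=
    { toFun := fun p => (p.2, p.1 - p.2)
      invFun := fun p => (p.1 + p.2, p.1)
      left_inv := fun p => by ext <;> simp
      right_inv := fun p => by ext <;> simp }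
  rw [tsum_mul_tsum_of_summable_norm hf hg, ← Equiv.tsum_eq e]
  exact (summable_conv_aux hf hg).tsum_prod.symm

lemma fourierSum_latticeConv {f g : ℤ × ℤ → ℂ} (hf : Summable fun k => ‖f k‖)
    (hg : Summable fun k => ‖g k‖) (u : ℝ × ℝ) :
    fourierSum (latticeConv f g) u = fourierSum f u * fourierSum g u := by
  rw [fourierSum, fourierSum, fourierSum, ← tsum_latticeConv]
  · refine tsum_congr fun t => ?_
    rw [latticeConv, latticeConv, ← tsum_mul_right]
    refine tsum_congr fun s => ?_
    have : latticeChar u t = latticeChar u s * latticeChar u (t - s) := by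
      rw [← latticeChar_add, add_sub_cancel]
    rw [this]
    ring
  · simpa [norm_latticeChar] using hf
  · simpa [norm_latticeChar] using hg

/-- If the sums of `f` over all residue classes modulo `M` vanish, so do those of `f * g`. -/
lemma tsum_class_latticeConv {f g : ℤ × ℤ → ℂ} (hf : Summable fun k => ‖f k‖)
    (hg : Summable fun k => ‖g k‖) (M : ℕ) (hM : 0 < M)
    (h : ∀ r : ℤ × ℤ, ∑' k : ℤ × ℤ, f (r + (M : ℤ) • k) = 0) (r : ℤ × ℤ) :
    ∑' k : ℤ × ℤ, latticeConv f g (r + (M : ℤ) • k) = 0 := by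
  have hinj : Function.Injective fun k : ℤ × ℤ => r + (M : ℤ) • k := by
    intro k k' hk
    have h0 : (M : ℤ) ≠ 0 := by exact_mod_cast hM.ne'
    exact smul_right_injective _ h0 (add_left_cancel hk)
  have hinj2 : Function.Injective
      fun p : (ℤ × ℤ) × (ℤ × ℤ) => ((r + (M : ℤ) • p.1, p.2) : (ℤ × ℤ) × (ℤ × ℤ)) := by
    rintro ⟨k, s⟩ ⟨k', s'⟩ hk
    rw [Prod.mk.injEq] at hk ⊢
    exact ⟨hinj hk.1, hk.2⟩
  have hs := (summable_conv_aux hf hg).comp_injective hinj2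
  -- The class sum of the convolution is `∑ f s * P (r - s)` with `P` the `M`-periodization of `g`.
  -- On each class of `s` the factor `P (r - s)` is constant and the sum of `f` is zero.
  set P : ℤ × ℤ → ℂ := fun x => ∑' k : ℤ × ℤ, g (x + (M : ℤ) • k) with hP
  have hper : ∀ x k, P (x + (M : ℤ) • k) = P x := by
    intro x k
    simp only [hP]
    rw [← Equiv.tsum_eq (Equiv.addLeft k) fun j => g (x + (M : ℤ) • j)]
    refine tsum_congr fun j => ?_
    rw [Equiv.coe_addLeft, smul_add, add_assoc]
  have h1 : ∑' k : ℤ × ℤ, latticeConv f g (r + (M : ℤ) • k) = ∑' s, f s * P (r - s) := by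
    simp only [latticeConv]
    rw [Summable.tsum_comm (f := fun s k => f s * g (r + (M : ℤ) • k - s)) hs.prod_symm]
    refine tsum_congr fun s => ?_
    rw [hP, ← tsum_mul_left]
    refine tsum_congr fun k => ?_
    congr 2
    abel
  have hs2 : Summable fun s => f s * P (r - s) := by
    have := (hs.prod_symm).prod
    refine this.congr fun s => ?_
    rw [hP, ← tsum_mul_left]
    refine tsum_congr fun k => ?_
    simp only [Function.comp, Prod.swap]
    congr 2
    abel
  rw [h1, tsum_int_sq_split M hM _ hs2]
  refine Finset.sum_eq_zero fun i _ => ?_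
  have h2 : ∀ k : ℤ × ℤ, f (M * k.1 + i.1, M * k.2 + i.2) * P (r - (M * k.1 + i.1, M * k.2 + i.2)) =
      f (((i.1 : ℤ), (i.2 : ℤ)) + (M : ℤ) • k) * P (r - ((i.1 : ℤ), (i.2 : ℤ))) := by
    intro k
    have e1 : ((M * k.1 + i.1, M * k.2 + i.2) : ℤ × ℤ) = ((i.1 : ℤ), (i.2 : ℤ)) + (M : ℤ) • k := by
      ext <;> simp [add_comm]
    rw [e1, ← hper (r - ((i.1 : ℤ), (i.2 : ℤ))) (-k)]
    congr 2
    rw [smul_neg]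
    abel
  simp only [h2, tsum_mul_right, h, zero_mul]

/-! ### Theta functions of low level are determined by their values at torsion points -/

namespace TorusForm

variable (τ : TorusForm)

/-- The bilinear form attached to `quad`, on `ℤ²`. -/
def bil (a b : ℤ × ℤ) : ℂ :=
  τ.τ₁ * a.1 * b.1 + τ.τ₂ * a.2 * b.2 + τ.τ₃ * (a.1 * b.2 + a.2 * b.1)

/-- The exponential of a quadratic polynomial with leading part
`πi c (τ₁ a₁² + τ₂ a₂² + 2 τ₃ a₁ a₂)` and linear part `α a₁ + β a₂`. -/
def expQuad (c : ℝ) (α β : ℂ) (a : ℤ × ℤ) : ℂ :=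
  cexp (Real.pi * I * c * τ.quad a.1 a.2 + α * a.1 + β * a.2)

lemma expQuad_ne_zero (c : ℝ) (α β : ℂ) (a : ℤ × ℤ) : τ.expQuad c α β a ≠ 0 := Complex.exp_ne_zero _

lemma rapidDecay_expQuad {c : ℝ} (hc : 0 < c) (α β : ℂ) : RapidDecay (τ.expQuad c α β) := by
  obtain ⟨ε, hε, h⟩ := τ.exists_quad_im_ge
  refine RapidDecay.of_gauss (δ := Real.pi * c * ε) (C := 1) (A := max ‖α‖ ‖β‖)
    (by have := Real.pi_pos; positivity) fun a => ?_
  rw [one_mul, expQuad, Complex.norm_exp, gauss, ← Real.exp_add]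
  apply Real.exp_le_exp.2
  rw [Complex.add_re, Complex.add_re]
  have h1 : (Real.pi * I * (c : ℂ) * τ.quad a.1 a.2).re =
      -(Real.pi * c * (τ.quad a.1 a.2).im) := by
    rw [show (Real.pi * I * (c : ℂ) * τ.quad a.1 a.2) =
      ((Real.pi * c : ℝ) : ℂ) * (I * τ.quad a.1 a.2) by push_cast; ring, Complex.re_ofReal_mul]
    simp
  have h2 : ∀ (γ : ℂ) (x : ℤ), ‖γ‖ ≤ max ‖α‖ ‖β‖ → (γ * x).re ≤ max ‖α‖ ‖β‖ * |(x : ℝ)| := by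
    intro γ x hγ
    refine (Complex.re_le_norm _).trans ?_
    rw [norm_mul, Complex.norm_intCast]
    exact mul_le_mul_of_nonneg_right hγ (abs_nonneg _)
  have h3 := h2 α a.1 (le_max_left _ _)
  have h4 := h2 β a.2 (le_max_right _ _)
  have h5 := mul_le_mul_of_nonneg_left (h a.1 a.2)
    (show 0 ≤ Real.pi * c by have := Real.pi_pos; positivity)
  rw [h1]
  linarith

variable {τ}

/-- This is quasi-periodicity read on coefficients. The cross term has the factor `2πi / M` whatever
the level `n`, so in a convolution the cross terms for `s` and `t - s` combine into one depending
only on `t`, while the leading coefficients `n / M` and `k / M` add up to `1`. -/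
lemma expQuad_add_smul {n M : ℕ} (hn : 0 < n) (hM : 0 < M) (α β : ℂ) (s a : ℤ × ℤ) :
    τ.expQuad (1 / (M * n)) α β (s + (n : ℤ) • a) = τ.expQuad (1 / (M * n)) α β s *
      cexp (Real.pi * I * (n / M) * τ.quad a.1 a.2 + 2 * Real.pi * I / M * τ.bil a s +
        n * (α * a.1 + β * a.2)) := by
  have hn' : (n : ℂ) ≠ 0 := by exact_mod_cast hn.ne'
  have hM' : (M : ℂ) ≠ 0 := by exact_mod_cast hM.ne'
  rw [expQuad, expQuad, ← Complex.exp_add]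
  congr 1
  simp only [quad, bil, Prod.fst_add, Prod.snd_add, Prod.smul_fst, Prod.smul_snd, smul_eq_mul]
  push_cast
  field_simp
  ring

/-- An auxiliary theta series of level `k`, supported on `kℤ²`. -/
def auxTheta (τ : TorusForm) (M k : ℕ) (v : ℝ × ℝ) (t : ℤ × ℤ) : ℂ :=
  if (k : ℤ) ∣ t.1 ∧ (k : ℤ) ∣ t.2 then
    τ.expQuad (1 / (M * k)) 0 0 t * latticeChar v (t.1 / k, t.2 / k) else 0

lemma norm_auxTheta_le (M k : ℕ) (v : ℝ × ℝ) (t : ℤ × ℤ) :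
    ‖τ.auxTheta M k v t‖ ≤ ‖τ.expQuad (1 / (M * k)) 0 0 t‖ := by
  rw [auxTheta]
  split_ifs
  · rw [norm_mul, norm_latticeChar, mul_one]
  · simp

lemma auxTheta_add_smul {k M : ℕ} (hk : 0 < k) (hM : 0 < M) (v : ℝ × ℝ) (t a : ℤ × ℤ) :
    τ.auxTheta M k v (t + (k : ℤ) • a) = τ.auxTheta M k v t *
      (cexp (Real.pi * I * (k / M) * τ.quad a.1 a.2 + 2 * Real.pi * I / M * τ.bil a t) *
        latticeChar v a) := by
  have hk' : (k : ℤ) ≠ 0 := by exact_mod_cast hk.ne'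
  have h1 : ((k : ℤ) ∣ (t + (k : ℤ) • a).1 ∧ (k : ℤ) ∣ (t + (k : ℤ) • a).2) ↔
      ((k : ℤ) ∣ t.1 ∧ (k : ℤ) ∣ t.2) := by
    simp
  rw [auxTheta, auxTheta]
  simp only [h1]
  split_ifs with h
  · have h2 : (((t + (k : ℤ) • a).1 / k, (t + (k : ℤ) • a).2 / k) : ℤ × ℤ) =
        (t.1 / k, t.2 / k) + a := by
      ext <;> simp [Int.add_mul_ediv_left _ _ hk']
    rw [h2, latticeChar_add, expQuad_add_smul hk hM]
    simp only [zero_mul, add_zero, mul_zero]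
    ring
  · simp

/-- Exchanging the roles of the point `z` and the translation `v` turns nonvanishing of the
auxiliary theta function at a given `z` into a generic condition on `v`. -/
lemma fourierSum_auxTheta {k M : ℕ} (hk : 0 < k) (v z : ℝ × ℝ) :
    fourierSum (τ.auxTheta M k v) z =
      fourierSum (fun a => τ.expQuad (k / M) 0 0 a * latticeChar z ((k : ℤ) • a)) v := by
  have hk' : (k : ℤ) ≠ 0 := by exact_mod_cast hk.ne'
  have hinj : Function.Injective fun a : ℤ × ℤ => (k : ℤ) • a := smul_right_injective _ hk'
  rw [fourierSum, fourierSum, ← hinj.tsum_eq]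
  · refine tsum_congr fun a => ?_
    rw [auxTheta, if_pos (by simp)]
    have h2 : (((((k : ℤ) • a).1 / k, ((k : ℤ) • a).2 / k)) : ℤ × ℤ) = a := by
      ext <;> simp [Int.mul_ediv_cancel_left _ hk']
    rw [h2]
    have h3 : τ.expQuad (1 / (M * k)) 0 0 ((k : ℤ) • a) = τ.expQuad (k / M) 0 0 a := by
      simp only [expQuad, quad, Prod.smul_fst, Prod.smul_snd, smul_eq_mul]
      congr 1
      push_cast
      field_simp
      ring
    rw [h3]
    ring
  · intro t ht
    by_cases h : (k : ℤ) ∣ t.1 ∧ (k : ℤ) ∣ t.2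
    · obtain ⟨⟨x, hx⟩, y, hy⟩ := h
      exact ⟨(x, y), by ext <;> simp [hx, hy]⟩
    · exact absurd (show τ.auxTheta M k v t * latticeChar z t = 0 by
        rw [auxTheta, if_neg h, zero_mul]) ht

/-- A theta function of level `n < M` for the form `τ / M`, whose sums of Fourier coefficients over
all residue classes modulo `M` vanish (that is, which vanishes at the points of `(1/M) ℤ²`), is
zero. -/
theorem eq_zero_of_tsum_class_eq_zero {n k M : ℕ} (hn : 0 < n) (hk : 0 < k) (hM : M = n + k)
    (α β : ℂ) (u : ℝ × ℝ) (μ : ℤ × ℤ → ℂ) (C : ℝ) (hC : ∀ s, ‖μ s‖ ≤ C)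
    (hμ : ∀ s a, μ (s + (n : ℤ) • a) = latticeChar u a * μ s)
    (h0 : ∀ r : ℤ × ℤ, ∑' a : ℤ × ℤ,
      τ.expQuad (1 / (M * n)) α β (r + (M : ℤ) • a) * μ (r + (M : ℤ) • a) = 0) (s : ℤ × ℤ) :
    μ s = 0 := by
  have hMp : 0 < M := by omega
  have hn' : (0 : ℝ) < n := by exact_mod_cast hn
  have hk' : (0 : ℝ) < k := by exact_mod_cast hk
  have hM' : (0 : ℝ) < M := by exact_mod_cast hMp
  have hMc : (M : ℂ) ≠ 0 := by exact_mod_cast hMp.ne'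
  set f : ℤ × ℤ → ℂ := fun s => τ.expQuad (1 / (M * n)) α β s * μ s with hf
  have hfs : Summable fun k => ‖f k‖ := by
    refine ((τ.rapidDecay_expQuad (c := 1 / (M * n)) (by positivity) α β).of_norm_le C
      fun k => ?_).summable_norm
    rw [hf, norm_mul, mul_comm]
    exact mul_le_mul_of_nonneg_right (hC k) (norm_nonneg _)
  suffices hz : ∀ z, fourierSum f z = 0 by
    have := eq_zero_of_fourierSum_eq_zero hfs.of_norm hz s
    exact (mul_eq_zero.1 this).resolve_left (τ.expQuad_ne_zero _ _ _ _)
  intro z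
  -- The convolution at `t + M a` will be its value at `t` times `D t a * latticeChar v a`, so its
  -- sum over the class of `t` is that value times `fourierSum (D t) v`. The value of the auxiliary
  -- theta function at `z` is `fourierSum E v`. The point `v` must avoid the zeros of `E` (index
  -- `none`) and of `D` at the `M²` representatives (indices `some`).
  let D : ℤ × ℤ → ℤ × ℤ → ℂ := fun t a => τ.expQuad 1
    (2 * Real.pi * I / M * (τ.τ₁ * t.1 + τ.τ₃ * t.2) + n * α)
    (2 * Real.pi * I / M * (τ.τ₂ * t.2 + τ.τ₃ * t.1) + n * β) a * latticeChar u a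
  let E : ℤ × ℤ → ℂ := fun a => τ.expQuad (k / M) 0 0 a * latticeChar z ((k : ℤ) • a)
  have hE : RapidDecay E := (τ.rapidDecay_expQuad (c := k / M) (by positivity) 0 0).of_norm_le 1
    fun a => by simp only [E]; rw [norm_mul, norm_latticeChar]; simp
  have hD : ∀ t, RapidDecay (D t) := fun t =>
    (τ.rapidDecay_expQuad one_pos _ _).mul_latticeChar u
  obtain ⟨v, hv⟩ := RapidDecay.exists_forall_fourierSum_ne_zero
    (insert none (((Finset.range M ×ˢ Finset.range M).image
      fun i : ℕ × ℕ => ((i.1 : ℤ), (i.2 : ℤ))).image some))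
    (fun o : Option (ℤ × ℤ) => o.elim E D)
    (fun o => by cases o; exacts [hE, hD _]) (fun _ => 0)
    (fun o => by
      cases o
      exacts [mul_ne_zero (τ.expQuad_ne_zero _ _ _ _) (latticeChar_ne_zero _ _),
        mul_ne_zero (τ.expQuad_ne_zero _ _ _ _) (latticeChar_ne_zero _ _)])
  have hvE : fourierSum E v ≠ 0 := hv none (Finset.mem_insert_self _ _)
  have hvD : ∀ i ∈ Finset.range M ×ˢ Finset.range M,
      fourierSum (D ((i.1 : ℤ), (i.2 : ℤ))) v ≠ 0 := fun i hi =>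
    hv (some ((i.1 : ℤ), (i.2 : ℤ))) (Finset.mem_insert_of_mem
      (Finset.mem_image_of_mem _ (Finset.mem_image_of_mem _ hi)))
  set g := τ.auxTheta M k v with hg
  have hgs : Summable fun t => ‖g t‖ :=
    Summable.of_nonneg_of_le (fun _ => norm_nonneg _) (norm_auxTheta_le M k v)
      (τ.rapidDecay_expQuad (c := 1 / (M * k)) (by positivity) 0 0).summable_norm
  -- Shift the summation variable by `n a`: as `M = n + k`, the argument of `g` shifts by `k a`, and
  -- both factors transform by their own quasi-periodicity.
  have hconv : ∀ t a, latticeConv f g (t + (M : ℤ) • a) =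
      latticeConv f g t * (D t a * latticeChar v a) := by
    intro t a
    rw [latticeConv, latticeConv, ← tsum_mul_right, ← Equiv.tsum_eq (Equiv.addRight ((n : ℤ) • a))]
    refine tsum_congr fun s => ?_
    have e1 : t + (M : ℤ) • a - (s + (n : ℤ) • a) = (t - s) + (k : ℤ) • a := by
      rw [hM]; push_cast; rw [add_smul]; abel
    rw [Equiv.coe_addRight, e1, hg, auxTheta_add_smul hk hMp]
    simp only [hf, D]
    rw [hμ, expQuad_add_smul hn hMp]
    have e2 : cexp (Real.pi * I * (n / M) * τ.quad a.1 a.2 + 2 * Real.pi * I / M * τ.bil a s +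
        n * (α * a.1 + β * a.2)) *
        cexp (Real.pi * I * (k / M) * τ.quad a.1 a.2 + 2 * Real.pi * I / M * τ.bil a (t - s)) =
        τ.expQuad 1 (2 * Real.pi * I / M * (τ.τ₁ * t.1 + τ.τ₃ * t.2) + n * α)
          (2 * Real.pi * I / M * (τ.τ₂ * t.2 + τ.τ₃ * t.1) + n * β) a := by
      rw [expQuad, ← Complex.exp_add]
      congr 1
      have e3 : (n : ℂ) / M + k / M = 1 := by
        rw [← add_div, hM]; push_cast; exact div_self (by rw [hM] at hMc; exact_mod_cast hMc)
      simp only [bil, Prod.fst_sub, Prod.snd_sub]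
      push_cast
      linear_combination (Real.pi * I * τ.quad a.1 a.2) * e3
    rw [← e2]
    ring
  have hcl := tsum_class_latticeConv hfs hgs M hMp h0
  have hr : ∀ i ∈ Finset.range M ×ˢ Finset.range M,
      latticeConv f g ((i.1 : ℤ), (i.2 : ℤ)) = 0 := by
    intro i hi
    have h1 := hcl ((i.1 : ℤ), (i.2 : ℤ))
    simp only [hconv, tsum_mul_left] at h1
    exact (mul_eq_zero.1 h1).resolve_right (hvD i hi)
  have hconv0 : latticeConv f g = 0 := by
    funext t
    have hMz : (0 : ℤ) < M := by exact_mod_cast hMp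
    have e : t = (((t.1 % M).toNat : ℤ), ((t.2 % M).toNat : ℤ)) +
        (M : ℤ) • ((t.1 / M, t.2 / M) : ℤ × ℤ) := by
      ext
      · simp [Int.toNat_of_nonneg (Int.emod_nonneg t.1 hMz.ne'), Int.emod_add_mul_ediv]
      · simp [Int.toNat_of_nonneg (Int.emod_nonneg t.2 hMz.ne'), Int.emod_add_mul_ediv]
    rw [e, hconv, hr ((t.1 % M).toNat, (t.2 % M).toNat), zero_mul, Pi.zero_apply]
    have h1 := Int.emod_lt_of_pos t.1 hMz
    have h2 := Int.emod_lt_of_pos t.2 hMz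
    simp only [Finset.mem_product, Finset.mem_range]
    omega
  have h2 := fourierSum_latticeConv hfs hgs z
  rw [hconv0, hg, fourierSum_auxTheta hk] at h2
  refine (mul_eq_zero.1 (h2.symm.trans ?_)).resolve_right hvE
  simp [fourierSum]

end TorusForm

/-! ### Finite sums of periodic functions -/

/-- Sums of periodic functions over a period do not change under translation. -/
lemma sum_range_periodic (M : ℕ) (G : ℤ → ℂ) (hG : ∀ x, G (x + M) = G x) (y : ℤ) :
    ∑ i ∈ Finset.range M, G (i + y) = ∑ i ∈ Finset.range M, G i := by
  have key : ∀ y : ℤ, ∑ i ∈ Finset.range M, G (i + (y + 1)) = ∑ i ∈ Finset.range M, G (i + y) := by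
    intro y
    have h1 := Finset.sum_range_succ (fun i : ℕ => G (i + y)) M
    have h2 := Finset.sum_range_succ' (fun i : ℕ => G (i + y)) M
    have h3 : G ((M : ℤ) + y) = G (((0 : ℕ) : ℤ) + y) := by
      rw [add_comm, hG]; simp
    rw [h1, h3] at h2
    rw [add_right_cancel h2]
    refine Finset.sum_congr rfl fun i _ => ?_
    congr 1
    push_cast
    ring
  induction y using Int.induction_on with
  | zero => simp
  | succ i ih => rw [key, ih]
  | pred i ih => rw [← ih, ← key, sub_add_cancel]

lemma sum_range_prod_periodic (M : ℕ) (G : ℤ × ℤ → ℂ) (hG : ∀ x a, G (x + (M : ℤ) • a) = G x)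
    (y : ℤ × ℤ) :
    ∑ i ∈ Finset.range M ×ˢ Finset.range M, G (((i.1 : ℤ), (i.2 : ℤ)) + y) =
      ∑ i ∈ Finset.range M ×ˢ Finset.range M, G ((i.1 : ℤ), (i.2 : ℤ)) := by
  rw [Finset.sum_product, Finset.sum_product]
  have h1 : ∀ i : ℕ, ∑ j ∈ Finset.range M, G (((i : ℤ), (j : ℤ)) + y) =
      ∑ j ∈ Finset.range M, G ((i : ℤ) + y.1, (j : ℤ)) := fun i =>
    sum_range_periodic M (fun x => G ((i : ℤ) + y.1, x)) (fun x => by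
      rw [← hG (_, x) (0, 1)]; simp) y.2
  simp only [h1]
  exact sum_range_periodic M (fun x => ∑ j ∈ Finset.range M, G (x, (j : ℤ))) (fun x =>
    Finset.sum_congr rfl fun j _ => by rw [← hG (x, _) (1, 0)]; simp) y.1

/-! ### Reflection symmetry and commutativity -/

namespace TorusForm

variable (τ : TorusForm)

lemma quad_neg (u v : ℝ) : τ.quad (-u) (-v) = τ.quad u v := by
  simp only [quad]
  push_cast
  ring

lemma triangleWeight_neg_swap (k l : ℕ) (u v : ℝ) :
    τ.triangleWeight l k (-u) (-v) = τ.triangleWeight k l u v := by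
  rw [triangleWeight, triangleWeight, quad_neg, add_comm (k : ℝ),
    show (3 * l * k : ℝ) = 3 * k * l by ring]

/-- The substitution `m ↦ -1 - m` turns `m + a/6` into `-(m + (6 - a)/6)`, and the quadratic form is
even. -/
lemma theta_symm (a₁ a₂ : ℤ) : τ.theta a₁ a₂ 0 0 1 = τ.theta (6 - a₁) (6 - a₂) 0 0 1 := by
  rw [theta, theta, ← Equiv.tsum_eq ((Equiv.subLeft (-1 : ℤ)).prodCongr (Equiv.subLeft (-1 : ℤ)))]
  refine tsum_congr fun m => ?_
  simp only [Equiv.prodCongr_apply, Prod.map_fst, Prod.map_snd, Equiv.subLeft_apply]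
  push_cast
  congr 1
  · congr 1 <;> (congr 1; ring)
  · congr 1; ring

end TorusForm

namespace FukayaRing

variable {τ : TorusForm}

/-- Exchanging the two factors reflects the triangle. The reflected index is an integer because `b`
is, and this is the only place where integrality of the translation matters. -/
lemma disp_swap (k l : ℕ+) (a c b n : ℤ) :
    disp l k c a b (-n - (k + l) * b) = -disp k l a c b n := by
  simp only [disp, pointCoord]
  push_cast
  ring

lemma Y_mul_comm (n₁ n₂ : ℤ) (k l : ℕ+) (a₁ a₂ c₁ c₂ : ℤ) :
    Y τ n₁ n₂ k a₁ a₂ * Y τ n₁ n₂ l c₁ c₂ = Y τ n₁ n₂ l c₁ c₂ * Y τ n₁ n₂ k a₁ a₂ := by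
  rw [Y_mul_Y, Y_mul_Y]
  refine ext_functional fun F => ?_
  rw [functional_mulPoint, functional_mulPoint]
  -- The reflection of `disp_swap` in both coordinates. It changes the output labels by `3 (k + l)`
  -- times the integers `n.i + k nᵢ`, so the basis element is unchanged.
  let e : ℤ × ℤ ≃ ℤ × ℤ := (Equiv.neg (ℤ × ℤ)).trans
    (Equiv.subRight ((k + l : ℤ) * n₁, (k + l : ℤ) * n₂))
  have he : ∀ n, e n = (-n.1 - (k + l) * n₁, -n.2 - (k + l) * n₂) := fun n => rfl
  rw [← Equiv.tsum_eq e fun n : ℤ × ℤ =>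
      τ.triangleWeight l k (disp l k c₁ a₁ n₁ n.1) (disp l k c₂ a₂ n₂ n.2) *
        F (Y τ n₁ n₂ (l + k) (c₁ + a₁ + 3 * k * n.1) (c₂ + a₂ + 3 * k * n.2))]
  refine tsum_congr fun n => ?_
  simp only [he]
  rw [disp_swap, disp_swap, TorusForm.triangleWeight_neg_swap]
  congr 2
  refine Y_congr (add_comm _ _) ⟨n.1 + k * n₁, ?_⟩ ⟨n.2 + k * n₂, ?_⟩ <;> (push_cast; ring)

/-- For integral translation vectors the ring `R(T)` is commutative. -/
lemma mul_comm_of_int (n₁ n₂ : ℤ) (x y : FukayaRing τ n₁ n₂) : x * y = y * x := by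
  have key : ∀ g h : Generator, basis τ n₁ n₂ g * basis τ n₁ n₂ h =
      basis τ n₁ n₂ h * basis τ n₁ n₂ g := by
    intro g h
    cases g with
    | one => rw [← one_def, one_mul, mul_one]
    | point k a₁ a₂ =>
      cases h with
      | one => rw [← one_def, one_mul, mul_one]
      | point l c₁ c₂ => simp only [basis_point, Y_mul_comm]
  induction x using induction_basis with
  | h0 => simp
  | hadd x x' hx hx' => rw [add_mul, mul_add, hx, hx']
  | hsmul s g =>
    induction y using induction_basis with
    | h0 => simp
    | hadd y y' hy hy' => rw [add_mul, mul_add, hy, hy']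
    | hsmul s' h => rw [smul_mul_smul_comm, smul_mul_smul_comm, key, mul_comm s]

/-! ### Generation in degree one -/

variable {b₁ b₂ : ℝ}

/-- Expanding the square separates a nonzero constant, irrelevant for vanishing, from a Gaussian in
`s`. The linear part comes from the translation and does not depend on `l`. -/
lemma triangleWeight_one (τ : TorusForm) (b₁ b₂ : ℝ) (l : ℕ+) (s : ℤ × ℤ) :
    τ.triangleWeight 1 l ((s.1 : ℝ) / (3 * (l : ℕ)) + ((l : ℕ) + 1) * b₁ / 2)
      ((s.2 : ℝ) / (3 * (l : ℕ)) + ((l : ℕ) + 1) * b₂ / 2) =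
    cexp (3 * Real.pi * I * (l : ℕ) * ((l : ℕ) + 1) / 4 * τ.quad b₁ b₂) *
      τ.expQuad (1 / (((3 * (l : ℕ) : ℕ) : ℝ) * (((l : ℕ) + 1 : ℕ) : ℝ)))
        (Real.pi * I * (τ.τ₁ * b₁ + τ.τ₃ * b₂)) (Real.pi * I * (τ.τ₂ * b₂ + τ.τ₃ * b₁)) s := by
  have hl : ((l : ℕ) : ℂ) ≠ 0 := by exact_mod_cast l.ne_zero
  have hl' : ((l : ℕ) + 1 : ℂ) ≠ 0 := Nat.cast_add_one_ne_zero _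
  have hl'' : (1 + (l : ℕ) : ℂ) ≠ 0 := by rwa [add_comm]
  rw [TorusForm.triangleWeight, TorusForm.expQuad, ← Complex.exp_add]
  congr 1
  simp only [TorusForm.quad]
  push_cast
  field_simp
  ring

/-- A linear functional that vanishes on all products of an element of degree `1` and an element of
degree `l ≥ 1` vanishes in degree `1 + l`. -/
theorem functional_eq_zero (F : FukayaRing τ b₁ b₂ →ₗ[ℂ] ℂ) (l : ℕ+)
    (h : ∀ a₁ a₂ c₁ c₂ : ℤ, F (Y τ b₁ b₂ 1 a₁ a₂ * Y τ b₁ b₂ l c₁ c₂) = 0) (e₁ e₂ : ℤ) :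
    F (Y τ b₁ b₂ (1 + l) e₁ e₂) = 0 := by
  obtain ⟨B, hB0, hB⟩ := exists_functional_Y_le F (1 + l)
  have hlp : 0 < (l : ℕ) := l.pos
  set n : ℕ := (l : ℕ) + 1 with hn
  set M : ℕ := 3 * (l : ℕ) with hM
  set lam : ℤ × ℤ → ℂ := fun e => F (Y τ b₁ b₂ (1 + l) e.1 e.2) with hlam
  set α : ℂ := Real.pi * I * (τ.τ₁ * b₁ + τ.τ₃ * b₂) with hα
  set β : ℂ := Real.pi * I * (τ.τ₂ * b₂ + τ.τ₃ * b₁) with hβ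
  have hper : ∀ e a : ℤ × ℤ, lam (e + (3 * n : ℤ) • a) = lam e := by
    intro e a
    simp only [hlam]
    congr 1
    refine Y_congr rfl ⟨a.1, ?_⟩ ⟨a.2, ?_⟩ <;>
      (simp only [hn, Prod.fst_add, Prod.snd_add, Prod.smul_fst, Prod.smul_snd, smul_eq_mul,
        PNat.add_coe, PNat.one_coe]; push_cast; ring)
  -- With `c = r + l a`, the difference `c - l a` that governs the weights is `r`, independent of
  -- `a`, while the output label `a + c` becomes `r + n a`. One Gaussian thus tests all translates
  -- of `lam` by `nℤ²`.
  have hsum : ∀ r a : ℤ × ℤ, ∑' j : ℤ × ℤ, τ.expQuad (1 / ((M : ℝ) * n)) α β (r + (M : ℤ) • j) *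
      lam (r + (M : ℤ) • j + (n : ℤ) • a) = 0 := by
    intro r a
    have h1 := h a.1 a.2 (r.1 + l * a.1) (r.2 + l * a.2)
    rw [Y_mul_Y, functional_mulPoint] at h1
    have hd : ∀ (a r j : ℤ) (b : ℝ), disp ((1 : ℕ+) : ℕ) l a (r + l * a) b j =
        ((r + M * j : ℤ) : ℝ) / (3 * (l : ℕ)) + ((l : ℕ) + 1) * b / 2 := by
      intro a r j b
      have hl : ((l : ℕ) : ℝ) ≠ 0 := by exact_mod_cast l.ne_zero
      simp only [disp, pointCoord, hM]
      push_cast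
      field_simp
      ring
    have h2 : ∀ j : ℤ × ℤ, τ.triangleWeight ((1 : ℕ+) : ℕ) l
          (disp ((1 : ℕ+) : ℕ) l a.1 (r.1 + l * a.1) b₁ j.1)
          (disp ((1 : ℕ+) : ℕ) l a.2 (r.2 + l * a.2) b₂ j.2) *
        F (Y τ b₁ b₂ (1 + l) (a.1 + (r.1 + l * a.1) + 3 * l * j.1)
          (a.2 + (r.2 + l * a.2) + 3 * l * j.2)) =
        cexp (3 * Real.pi * I * (l : ℕ) * ((l : ℕ) + 1) / 4 * τ.quad b₁ b₂) *
        (τ.expQuad (1 / ((M : ℝ) * n)) α β (r + (M : ℤ) • j) *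
          lam (r + (M : ℤ) • j + (n : ℤ) • a)) := by
      intro j
      rw [hd, hd]
      have h3 := triangleWeight_one τ b₁ b₂ l (r + (M : ℤ) • j)
      simp only [Prod.fst_add, Prod.snd_add, Prod.smul_fst, Prod.smul_snd, smul_eq_mul] at h3
      rw [PNat.one_coe, h3, mul_assoc]
      congr 2
      simp only [hlam]
      congr 1
      refine Y_congr rfl ⟨0, ?_⟩ ⟨0, ?_⟩ <;> (simp [hn, hM]; ring)
    rw [tsum_congr h2, tsum_mul_left] at h1
    exact (mul_eq_zero.1 h1).resolve_left (Complex.exp_ne_zero _)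
  have hMp : 0 < M := by omega
  have hsm : ∀ r a : ℤ × ℤ, Summable fun j : ℤ × ℤ =>
      τ.expQuad (1 / ((M : ℝ) * n)) α β (r + (M : ℤ) • j) *
        lam (r + (M : ℤ) • j + (n : ℤ) • a) := by
    intro r a
    have hinj : Function.Injective fun k : ℤ × ℤ => r + (M : ℤ) • k := by
      intro k k' hk
      have h0 : (M : ℤ) ≠ 0 := by exact_mod_cast hMp.ne'
      exact smul_right_injective _ h0 (add_left_cancel hk)
    have hc : (0 : ℝ) < 1 / ((M : ℝ) * n) := by
      have h1 : (0 : ℝ) < M := by exact_mod_cast hMp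
      have h2 : (0 : ℝ) < n := by exact_mod_cast Nat.succ_pos _
      positivity
    have := ((τ.rapidDecay_expQuad hc α β).summable_norm.mul_right B).comp_injective hinj
    refine Summable.of_norm_bounded this fun j => ?_
    rw [norm_mul]
    exact mul_le_mul_of_nonneg_left (hB _ _) (norm_nonneg _)
  -- The function `lam` has period `3n`, not `n`; its Fourier components under translation by `nℤ²`
  -- modulo `3nℤ²` are multiplied by a character, as the vanishing theorem requires.
  have hμ0 : ∀ (p : ℕ × ℕ) (s : ℤ × ℤ), ∑ a ∈ Finset.range 3 ×ˢ Finset.range 3,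
      latticeChar ((p.1 : ℝ) / (3 : ℕ), (p.2 : ℝ) / (3 : ℕ)) ((a.1 : ℤ), (a.2 : ℤ)) *
        lam (s + (n : ℤ) • ((a.1 : ℤ), (a.2 : ℤ))) = 0 := by
    intro p s
    set u : ℝ × ℝ := ((p.1 : ℝ) / (3 : ℕ), (p.2 : ℝ) / (3 : ℕ)) with hu
    -- The complementary level is `M - n = 3l - (l + 1) = 2l - 1`, positive because `l ≥ 1`.
    -- Reindexing the sum over `a` puts the inverse character, `-u`, in the transformation law.
    refine TorusForm.eq_zero_of_tsum_class_eq_zero (τ := τ) (n := n) (k := 2 * l - 1) (M := M)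
      (by omega) (by omega) (by omega) α β (-u)
      (fun s => ∑ a ∈ Finset.range 3 ×ˢ Finset.range 3, latticeChar u ((a.1 : ℤ), (a.2 : ℤ)) *
        lam (s + (n : ℤ) • ((a.1 : ℤ), (a.2 : ℤ))))
      (∑ a ∈ Finset.range 3 ×ˢ Finset.range 3, B) ?_ ?_ ?_ s
    · intro s
      refine norm_sum_le_of_le _ fun a _ => ?_
      rw [norm_mul, norm_latticeChar, one_mul]
      exact hB _ _
    · intro s a
      have hu3 : ∀ x : ℤ × ℤ, latticeChar u (((3 : ℕ) : ℤ) • x) = 1 := by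
        intro x
        rw [latticeChar, Complex.exp_eq_one_iff]
        refine ⟨x.1 * p.1 + x.2 * p.2, ?_⟩
        simp only [hu, Prod.smul_fst, Prod.smul_snd, smul_eq_mul]
        push_cast
        field_simp
      have h1 := sum_range_prod_periodic 3
        (fun x => latticeChar u x * lam (s + (n : ℤ) • x)) (fun x y => by
          rw [latticeChar_add, hu3, mul_one, smul_add, ← add_assoc, smul_smul,
            show (n : ℤ) * ((3 : ℕ) : ℤ) = 3 * n by push_cast; ring, hper]) a
      have h2 : latticeChar (-u) a * latticeChar u a = 1 := by
        rw [← latticeChar_add_left, neg_add_cancel]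
        simp [latticeChar]
      rw [← h1, Finset.mul_sum]
      refine Finset.sum_congr rfl fun x _ => ?_
      rw [latticeChar_add, smul_add, ← add_assoc, add_right_comm s]
      linear_combination (-(latticeChar u ((x.1 : ℤ), (x.2 : ℤ)) *
        lam (s + (n : ℤ) • ((x.1 : ℤ), (x.2 : ℤ)) + (n : ℤ) • a))) * h2
    · intro r
      have h1 : ∀ j : ℤ × ℤ, τ.expQuad (1 / ((M : ℝ) * n)) α β (r + (M : ℤ) • j) *
          ∑ a ∈ Finset.range 3 ×ˢ Finset.range 3, latticeChar u ((a.1 : ℤ), (a.2 : ℤ)) *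
            lam (r + (M : ℤ) • j + (n : ℤ) • ((a.1 : ℤ), (a.2 : ℤ))) =
          ∑ a ∈ Finset.range 3 ×ˢ Finset.range 3, latticeChar u ((a.1 : ℤ), (a.2 : ℤ)) *
            (τ.expQuad (1 / ((M : ℝ) * n)) α β (r + (M : ℤ) • j) *
              lam (r + (M : ℤ) • j + (n : ℤ) • ((a.1 : ℤ), (a.2 : ℤ)))) := by
        intro j
        rw [Finset.mul_sum]
        exact Finset.sum_congr rfl fun a _ => by ring
      rw [tsum_congr h1, Summable.tsum_finsetSum fun a _ => (hsm r _).mul_left _]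
      refine Finset.sum_eq_zero fun a _ => ?_
      rw [tsum_mul_left, hsum, mul_zero]
  -- Fourier inversion: summing over all characters leaves nine times the term `a = 0`.
  have h9 : ∑ p ∈ Finset.range 3 ×ˢ Finset.range 3, ∑ a ∈ Finset.range 3 ×ˢ Finset.range 3,
      latticeChar ((p.1 : ℝ) / (3 : ℕ), (p.2 : ℝ) / (3 : ℕ)) ((a.1 : ℤ), (a.2 : ℤ)) *
        lam ((e₁, e₂) + (n : ℤ) • ((a.1 : ℤ), (a.2 : ℤ))) = 0 :=
    Finset.sum_eq_zero fun p _ => hμ0 p _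
  rw [Finset.sum_comm] at h9
  simp only [← Finset.sum_mul, sum_latticeChar 3 (by norm_num)] at h9
  rw [Finset.sum_eq_single (0, 0)] at h9
  · simpa [hlam] using h9
  · rintro ⟨x, y⟩ hxy hne
    rw [if_neg, zero_mul]
    rintro ⟨hx, hy⟩
    simp only [Finset.mem_product, Finset.mem_range] at hxy
    apply hne
    simp only at hx hy
    ext <;> simp only <;> omega
  · simp

/-- `R(T)` is generated in degree one. -/
theorem eq_top_of_Y_one_mem (S : Subalgebra ℂ (FukayaRing τ b₁ b₂))
    (hS : ∀ a₁ a₂, Y τ b₁ b₂ 1 a₁ a₂ ∈ S) : S = ⊤ := by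
  have hY : ∀ (l : ℕ+) (a₁ a₂ : ℤ), Y τ b₁ b₂ l a₁ a₂ ∈ S := by
    intro l
    induction l using PNat.recOn with
    | one => exact hS
    | succ l ih =>
      intro e₁ e₂
      by_contra hc
      -- If the element were outside `S`, some functional would vanish on `S` and not on it; but `S`
      -- contains all products of degrees `1` and `l`.
      obtain ⟨F, hF, hker⟩ := Submodule.exists_le_ker_of_notMem (p := Subalgebra.toSubmodule S) hc
      apply hF
      rw [add_comm]
      exact functional_eq_zero F l (fun a₁ a₂ c₁ c₂ => hker (S.mul_mem (hS _ _) (ih _ _))) e₁ e₂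
  rw [eq_top_iff]
  rintro x -
  induction x using induction_basis with
  | h0 => exact S.zero_mem
  | hadd x y hx hy => exact S.add_mem hx hy
  | hsmul c g =>
    refine S.smul_mem ?_ c
    cases g with
    | one => exact S.one_mem
    | point l a₁ a₂ => rw [basis_point]; exact hY _ _ _

end FukayaRing

/-! ### Surjections of graded algebras and closed immersions -/

open AlgebraicGeometry CategoryTheory HomogeneousLocalization

section Proj

variable {A B : Type} [CommRing A] [Algebra ℂ A] [CommRing B] [Algebra ℂ B]
  {𝒜 : ℕ → Submodule ℂ A} {ℬ : ℕ → Submodule ℂ B} [GradedAlgebra 𝒜] [GradedAlgebra ℬ]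

/-- A surjective homomorphism of graded rings is surjective in each degree. -/
lemma GradedRingHom.exists_mem_of_surjective (φ : GradedRingHom 𝒜 ℬ)
    (hs : Function.Surjective φ) {n : ℕ} {y : B} (hy : y ∈ ℬ n) : ∃ x ∈ 𝒜 n, φ x = y := by
  obtain ⟨x, rfl⟩ := hs y
  -- Any preimage can be replaced by its component of degree `n`, since `φ` respects components.
  refine ⟨DirectSum.decompose 𝒜 x n, SetLike.coe_mem _, ?_⟩
  rw [GradedRingHom.map_directSumDecompose, DirectSum.decompose_of_mem_same ℬ hy]

/-- A surjective homomorphism of graded rings maps the irrelevant ideal onto the irrelevant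
ideal. -/
lemma GradedRingHom.irrelevant_le_map_of_surjective (φ : GradedRingHom 𝒜 ℬ)
    (hs : Function.Surjective φ) :
    HomogeneousIdeal.irrelevant ℬ ≤ (HomogeneousIdeal.irrelevant 𝒜).map φ := by
  refine (HomogeneousIdeal.irrelevant_le _).mpr fun i hi y hy => ?_
  obtain ⟨x, hx, rfl⟩ := φ.exists_mem_of_surjective hs hy
  exact Ideal.mem_map_of_mem _ (HomogeneousIdeal.mem_irrelevant_of_mem 𝒜 hi hx)

lemma HomogeneousLocalization.Away.map_surjective (φ : GradedRingHom 𝒜 ℬ)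
    (hs : Function.Surjective φ) {d : ℕ} {s : A} (hd : s ∈ 𝒜 d) :
    Function.Surjective (Away.map φ s) := by
  intro y
  obtain ⟨n, b, hb, rfl⟩ := y.mk_surjective _ (φ.2 hd)
  obtain ⟨a, ha, rfl⟩ := φ.exists_mem_of_surjective hs hb
  exact ⟨Away.mk 𝒜 hd n a ha, Away.map_mk φ s hd n a ha⟩

/-- Sections over a basic open set of positive degree are the degree-zero localization, where a
fraction is lifted by lifting its numerator in the same degree. -/
lemma AlgebraicGeometry.Proj.app_surjective (φ : GradedRingHom 𝒜 ℬ)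
    (hφ : HomogeneousIdeal.irrelevant ℬ ≤ (HomogeneousIdeal.irrelevant 𝒜).map φ)
    (hs : Function.Surjective φ) {d : ℕ} (hd : 0 < d) {s : A} (hsd : s ∈ 𝒜 d) :
    Function.Surjective ((Proj.map φ hφ).app (Proj.basicOpen 𝒜 s)) := by
  have h := Proj.awayToSection_comp_appLE φ hφ hsd
  have hB : Function.Surjective (Proj.awayToSection ℬ (φ s)) := by
    rw [← Proj.basicOpenIsoAway_hom ℬ (φ s) (φ.2 hsd) hd]
    exact (ConcreteCategory.bijective_of_isIso _).2
  intro y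
  obtain ⟨z, rfl⟩ := hB y
  obtain ⟨w, rfl⟩ := HomogeneousLocalization.Away.map_surjective φ hs hsd z
  refine ⟨Proj.awayToSection 𝒜 s w, ?_⟩
  have h1 := ConcreteCategory.congr_hom h w
  rw [Scheme.Hom.app_eq_appLE]
  exact h1

/-- The morphism of projective spectra induced by a surjective homomorphism of graded algebras is
a closed immersion. -/
theorem AlgebraicGeometry.Proj.isClosedImmersion_map (φ : GradedRingHom 𝒜 ℬ)
    (hφ : HomogeneousIdeal.irrelevant ℬ ≤ (HomogeneousIdeal.irrelevant 𝒜).map φ)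
    (hs : Function.Surjective φ) : IsClosedImmersion (Proj.map φ hφ) := by
  -- Being a closed immersion is local on the target. These basic opens and their preimages are
  -- affine, so surjectivity on sections suffices.
  let U : (Σ i : PNat, 𝒜 i) → (Proj 𝒜).Opens := fun i => Proj.basicOpen 𝒜 (i.2 : A)
  have hU : iSup U = ⊤ := by
    rw [← (Proj.affineOpenCover 𝒜).openCover.iSup_opensRange]
    exact iSup_congr fun i => (Proj.opensRange_awayι 𝒜 _ i.2.2 i.1.2).symm
  refine IsZariskiLocalAtTarget.of_iSup_eq_top (P := @IsClosedImmersion) U hU fun i => ?_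
  have hA : IsAffine (U i).toScheme := Proj.isAffineOpen_basicOpen 𝒜 _ i.2.2 i.1.2
  have hB : IsAffine (Proj.map φ hφ ⁻¹ᵁ U i).toScheme :=
    Proj.isAffineOpen_basicOpen ℬ _ (φ.2 i.2.2) i.1.2
  refine IsClosedImmersion.of_surjective_of_isAffine _ ?_
  -- The restricted morphism is evaluated on the image of `⊤`, which equals `U i` only
  -- propositionally; hence the variable `V`.
  have h1 : ∀ V, V = U i → Function.Surjective ((Proj.map φ hφ).app V) := by
    rintro V rfl
    exact Proj.app_surjective φ hφ hs i.1.2 i.2.2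
  rw [morphismRestrict_appTop]
  exact (ConcreteCategory.bijective_of_isIso ((Proj ℬ).presheaf.map
    (eqToHom (image_morphismRestrict_preimage (Proj.map φ hφ) (U i) ⊤)).op)).2.comp
      (h1 _ (Scheme.Opens.ι_image_top _))

/-- On an affine chart both composites are `Spec` of a ring map out of `ℂ`, and these agree because
`φ` fixes scalars. -/
lemma AlgebraicGeometry.Proj.awayι_map_projStructureMap (φ : GradedRingHom 𝒜 ℬ)
    (hφ : HomogeneousIdeal.irrelevant ℬ ≤ (HomogeneousIdeal.irrelevant 𝒜).map φ)
    (hc : ∀ c : ℂ, φ (algebraMap ℂ A c) = algebraMap ℂ B c) {d : ℕ} (hd : 0 < d) (s : A)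
    (hs : s ∈ 𝒜 d) :
    Proj.awayι ℬ (φ s) (φ.2 hs) hd ≫ Proj.map φ hφ ≫ projStructureMap 𝒜 =
      Proj.awayι ℬ (φ s) (φ.2 hs) hd ≫ projStructureMap ℬ := by
  rw [projStructureMap, projStructureMap, Proj.awayι_comp_map_assoc φ hφ hd s hs,
    Proj.awayι_toSpecZero_assoc, Proj.awayι_toSpecZero_assoc, ← Spec.map_comp, ← Spec.map_comp,
    ← Spec.map_comp, ← CommRingCat.ofHom_comp, ← CommRingCat.ofHom_comp, ← CommRingCat.ofHom_comp]
  congr 2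
  ext c
  simp only [RingHom.comp_apply]
  change HomogeneousLocalization.val (HomogeneousLocalization.map _ _ (.mk _)) =
    HomogeneousLocalization.val (.mk _)
  rw [HomogeneousLocalization.map_mk, HomogeneousLocalization.val_mk,
    HomogeneousLocalization.val_mk]
  congr 1
  · exact hc c
  · exact Subtype.ext (map_one φ)

/-- The morphism of projective spectra induced by a homomorphism of graded `ℂ`-algebras is a
morphism over `ℂ`. -/
theorem AlgebraicGeometry.Proj.map_comp_projStructureMap (φ : GradedRingHom 𝒜 ℬ)
    (hφ : HomogeneousIdeal.irrelevant ℬ ≤ (HomogeneousIdeal.irrelevant 𝒜).map φ)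
    (hc : ∀ c : ℂ, φ (algebraMap ℂ A c) = algebraMap ℂ B c) :
    Proj.map φ hφ ≫ projStructureMap 𝒜 = projStructureMap ℬ :=
  (Proj.mapAffineOpenCover φ hφ).openCover.hom_ext _ _ fun s =>
    Proj.awayι_map_projStructureMap φ hφ hc s.1.2 s.2 s.2.2

/-- Substituting elements of degree `1` into a homogeneous polynomial of degree `n` gives an element
of degree `n`. -/
lemma aeval_mem_of_mem_homogeneousSubmodule {σ : Type} (f : σ → A) (hf : ∀ i, f i ∈ 𝒜 1) {n : ℕ}
    {p : MvPolynomial σ ℂ} (hp : p ∈ MvPolynomial.homogeneousSubmodule σ ℂ n) :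
    MvPolynomial.aeval f p ∈ 𝒜 n := by
  rw [MvPolynomial.mem_homogeneousSubmodule] at hp
  rw [p.as_sum, map_sum]
  refine Submodule.sum_mem _ fun d hd => ?_
  have hdeg := hp (MvPolynomial.mem_support_iff.1 hd)
  rw [MvPolynomial.aeval_monomial, ← Algebra.smul_def]
  refine Submodule.smul_mem _ _ ?_
  have := SetLike.prod_pow_mem_graded 𝒜 (fun _ : σ => 1) f d fun i (_ : i ∈ d.support) => hf i
  rw [← hdeg, Finsupp.weight_apply]
  exact this

end Proj

/-! ### The homomorphism from the polynomial ring -/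

namespace FukayaRing

variable {τ : TorusForm} {b₁ b₂ : ℝ}

section Commutative

variable (hcomm : ∀ x y : FukayaRing τ b₁ b₂, x * y = y * x)

/-- The homomorphism of graded algebras `ℂ[Z_{ij}] → R(T)` that maps `Z_{ij}` to `Y^1_{i,j}`. -/
def polyAlgHom : letI := commRing hcomm
    MvPolynomial (ZMod 3 × ZMod 3) ℂ →ₐ[ℂ] FukayaRing τ b₁ b₂ :=
  letI := commRing hcomm
  MvPolynomial.aeval fun p => Z τ b₁ b₂ p.1 p.2

lemma polyAlgHom_X (i j : ZMod 3) : polyAlgHom hcomm (MvPolynomial.X (i, j)) = Z τ b₁ b₂ i j := by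
  let := commRing hcomm
  exact MvPolynomial.aeval_X _ _

lemma polyAlgHom_mem {n : ℕ} {p : MvPolynomial (ZMod 3 × ZMod 3) ℂ} (hp : p ∈ polyGrading n) :
    polyAlgHom hcomm p ∈ grading τ b₁ b₂ n := by
  let := commRing hcomm
  exact aeval_mem_of_mem_homogeneousSubmodule (𝒜 := grading τ b₁ b₂) _
    (fun _ => Y_mem τ b₁ b₂ 1 _ _) hp

lemma polyAlgHom_surjective : Function.Surjective (polyAlgHom hcomm) := by
  let := commRing hcomm
  rw [← AlgHom.range_eq_top]
  refine eq_top_of_Y_one_mem _ fun a₁ a₂ => ⟨MvPolynomial.X ((a₁ : ZMod 3), (a₂ : ZMod 3)), ?_⟩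
  obtain ⟨s, hs⟩ := exists_val_eq 1 a₁
  obtain ⟨t, ht⟩ := exists_val_eq 1 a₂
  exact (polyAlgHom_X hcomm _ _).trans (Y_congr rfl ⟨s, hs⟩ ⟨t, ht⟩)

end Commutative

end FukayaRing

end

theorem mainTheorem2 (τ : TorusForm) (n₁ n₂ : ℤ) :
    (∀ a₁ a₂ : ℤ, τ.theta a₁ a₂ 0 0 1 = τ.theta (6 - a₁) (6 - a₂) 0 0 1) ∧
    ∃ hcomm : ∀ x y : FukayaRing τ n₁ n₂, x * y = y * x,
      letI : CommRing (FukayaRing τ n₁ n₂) := FukayaRing.commRing hcomm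
      letI : GradedAlgebra polyGrading := MvPolynomial.gradedAlgebra
      ∃ φ : GradedRingHom polyGrading (FukayaRing.grading τ n₁ n₂),
        (∀ c : ℂ, φ (MvPolynomial.C c) = algebraMap ℂ (FukayaRing τ n₁ n₂) c) ∧
        (∀ i j : ZMod 3, φ (MvPolynomial.X (i, j)) = FukayaRing.Z τ n₁ n₂ i j) ∧
        Function.Surjective φ ∧
        ∃ hφ : HomogeneousIdeal.irrelevant (FukayaRing.grading τ n₁ n₂) ≤
            (HomogeneousIdeal.irrelevant polyGrading).map φ,
          AlgebraicGeometry.IsClosedImmersion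
            (AlgebraicGeometry.Proj.map φ hφ : mirror hcomm ⟶ P8) ∧
          CategoryTheory.CategoryStruct.comp (AlgebraicGeometry.Proj.map φ hφ)
              (projStructureMap polyGrading) =
            projStructureMap (FukayaRing.grading τ n₁ n₂) := by
  refine ⟨τ.theta_symm, FukayaRing.mul_comm_of_int n₁ n₂, ?_⟩
  let : CommRing (FukayaRing τ n₁ n₂) :=
    FukayaRing.commRing (FukayaRing.mul_comm_of_int n₁ n₂)
  let : GradedAlgebra polyGrading := MvPolynomial.gradedAlgebra
  let ψ := FukayaRing.polyAlgHom (τ := τ) (FukayaRing.mul_comm_of_int n₁ n₂)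
  let φ : GradedRingHom polyGrading (FukayaRing.grading τ n₁ n₂) :=
    ⟨ψ.toRingHom, fun hp => FukayaRing.polyAlgHom_mem _ hp⟩
  have hC : ∀ c : ℂ, φ (MvPolynomial.C c) = algebraMap ℂ (FukayaRing τ n₁ n₂) c := ψ.commutes
  have hs : Function.Surjective φ := FukayaRing.polyAlgHom_surjective _
  -- Surjectivity rules out base points, so the morphism is defined on all of the mirror.
  have hφ := φ.irrelevant_le_map_of_surjective hs
  exact ⟨φ, hC, FukayaRing.polyAlgHom_X _, hs, hφ,
    AlgebraicGeometry.Proj.isClosedImmersion_map φ hφ hs,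
    AlgebraicGeometry.Proj.map_comp_projStructureMap φ hφ hC⟩
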